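/- Notation. For $X\in\mathbb R^{n\times p}$ let $\mathrm{vec}(X)\in\mathbb R^{np}$ be the vector of stacked columns, so $x_{kj}$ is coordinate $k+n(j-1)$. Let $\Phi$ be the standard normal distribution function, and let $\varphi(\cdot;\mu,\Omega)$ be the density of the normal distribution on $\mathbb R^{np}$ with mean $\mu$ and positive definite covariance $\Omega$. Let $\omega=\mathrm{diag}(\sqrt{\omega_{11}},\dots,\sqrt{\omega_{np,np}})$ and $\overline\Omega=\omega^{-1}\Omega\omega^{-1}$. A random $n\times p$ matrix has the matrix variate skew-normal distribution $SN_{n\times p}(M,\Omega,B,\delta)$ if its density is $$2\,\varphi(\mathrm{vec}X;\mathrm{vec}M,\Omega)\,\Phi\big(\mathrm{vec}(B)^T\omega^{-1}\mathrm{vec}(X-M)\big),\qquad \delta=\frac{\omega\overline\Omega\,\mathrm{vec}B}{\sqrt{1+\mathrm{vec}(B)^T\overline\Omega\,\mathrm{vec}(B)}} .$$ Given $\Omega$ and $\delta$, the skewness matrix is recovered by $\mathrm{vec}B=(1-\delta^T\Omega^{-1}\delta)^{-1/2}\,\omega\,\Omega^{-1}\delta$; we write $SN_{n\times p}(M,\Omega,*,\delta)$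 when the law is given through $\delta$. Theorem. Let $X\sim SN_{n\times p}(M,\Omega,B,\delta)$ and $Y\sim SN_{n\times p}(M',\Omega',B',\delta')$, where $\Omega=V\otimes\Sigma$, $\Omega'=V'\otimes\Sigma'$, and $V=(v_{ij}),V'=(v'_{ij})\in\mathbb R^{p\times p}$, $\Sigma=(\sigma_{kl}),\Sigma'=(\sigma'_{kl})\in\mathbb R^{n\times n}$ are positive definite; write $M=(m_{kj})$ and $M'=(m'_{kj})$. For $0\le\lambda\le1$ put $M_\lambda=\lambda M'+(1-\lambda)M$, $\Omega_\lambda=\lambda\Omega'+(1-\lambda)\Omega$, $\delta_\lambda=\lambda\delta'+(1-\lambda)\delta$. Let $\phi_\lambda$ be the density of $SN_{n\times p}(M_\lambda,\Omega_\lambda,*,\delta_\lambda)$, and let $\overline{\phi_\lambda}$ be the density of the matrix variate normal distribution with mean $M_\lambda$ and covariance $\Omega_\lambda-\delta_\lambda\delta_\lambda^T$. Let $f:\mathbb R^{n\times p}\to\mathbb R$ be twice differentiable, such that $E f(X)$ and $E f(Y)$ exist (that is, $f(X)$ and $f(Y)$ are integrable), and such that for every $\lambda\in[0,1]$, for $\psi=\phi_\lambda$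 and for $\psi=\overline{\phi_\lambda}$, and for all $k,l\in\{1,\dots,n\}$ and $i,j\in\{1,\dots,p\}$, the three functions $$f\,\psi,\qquad f\,\frac{\partial\psi}{\partial x_{kj}},\qquad \psi\,\frac{\partial f}{\partial x_{kj}}$$ tend to $0$ as $x_{li}\to+\infty$ and as $x_{li}\to-\infty$, for every choice of the other entries. Suppose that everywhere on $\mathbb R^{n\times p}$ 1. $\displaystyle\sum_{k,l=1}^n\sum_{i,j=1}^p (v'_{ij}\sigma'_{kl}-v_{ij}\sigma_{kl})\,\frac{\partial^2 f}{\partial x_{ki}\,\partial x_{lj}}\ge0$, 2. $\displaystyle\sum_{k=1}^n\sum_{j=1}^p (m'_{kj}-m_{kj})\,\frac{\partial f}{\partial x_{kj}}\ge0$, 3. $\displaystyle\sum_{k=1}^n\sum_{j=1}^p (\delta'_{k+n(j-1)}-\delta_{k+n(j-1)})\,\frac{\partial f}{\partial x_{kj}}\ge0$. Then $E f(Y)\ge E f(X)$. -/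

import Mathlib

open Real Set Filter Topology MeasureTheory ProbabilityTheory Matrix
open scoped Kronecker

noncomputable section

namespace SkewNormal

/-- Lebesgue measure (and the Borel σ-algebra) on the space of real `n × p` matrices. -/
instance matrixMeasureSpace {n p : ℕ} : MeasureSpace (Matrix (Fin n) (Fin p) ℝ) :=
  inferInstanceAs (MeasureSpace (Fin n → Fin p → ℝ))

/-- The distribution function `Φ` of the standard normal distribution on `ℝ`. -/
def stdNormalCDF (x : ℝ) : ℝ := cdf (gaussianReal 0 1) x

section Vector

variable {ι : Type*} [Fintype ι] [DecidableEq ι]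

/-- The density of the multivariate normal distribution with mean `μ` and covariance `Ω`. -/
def normalPDF (μ : ι → ℝ) (Ω : Matrix ι ι ℝ) (z : ι → ℝ) : ℝ :=
  (√((2 * π) ^ Fintype.card ι * Ω.det))⁻¹ *
    Real.exp (-(1 / 2) * ((z - μ) ⬝ᵥ (Ω⁻¹ *ᵥ (z - μ))))

/-- The diagonal matrix `ω` of the standard deviations `√Ω_ii`. -/
def scaleDiag (Ω : Matrix ι ι ℝ) : Matrix ι ι ℝ := Matrix.diagonal fun i => √(Ω i i)

/-- The correlation matrix `ω⁻¹ Ω ω⁻¹` associated with `Ω`. -/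
def corrMatrix (Ω : Matrix ι ι ℝ) : Matrix ι ι ℝ := (scaleDiag Ω)⁻¹ * Ω * (scaleDiag Ω)⁻¹

/-- The density `2 φ(z; μ, Ω) Φ(αᵀ ω⁻¹ (z - μ))` of the skew-normal distribution
`SN(μ, Ω, α)`. -/
def skewNormalPDF (μ : ι → ℝ) (Ω : Matrix ι ι ℝ) (α : ι → ℝ) (z : ι → ℝ) : ℝ :=
  2 * normalPDF μ Ω z * stdNormalCDF (α ⬝ᵥ ((scaleDiag Ω)⁻¹ *ᵥ (z - μ)))

/-- The parameter `δ = (1 + αᵀ Ω̄ α)^(-1/2) ω Ω̄ α` of `SN(μ, Ω, α)`, where `Ω̄` is the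
correlation matrix. -/
def deltaOfAlpha (Ω : Matrix ι ι ℝ) (α : ι → ℝ) : ι → ℝ :=
  (√(1 + α ⬝ᵥ (corrMatrix Ω *ᵥ α)))⁻¹ • ((scaleDiag Ω * corrMatrix Ω) *ᵥ α)

/-- The skewness parameter `α = (1 - δᵀ Ω⁻¹ δ)^(-1/2) ω Ω⁻¹ δ` that belongs to the scale `Ω` and
the parameter `δ`. -/
def alphaOfDelta (Ω : Matrix ι ι ℝ) (δ : ι → ℝ) : ι → ℝ :=
  (√(1 - δ ⬝ᵥ (Ω⁻¹ *ᵥ δ)))⁻¹ • ((scaleDiag Ω * Ω⁻¹) *ᵥ δ)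

end Vector

section MatrixVariate

variable {n p : ℕ}

/-- The law of the matrix variate skew-normal distribution `SN_{n × p}(M, Ω, B)`: its density at
`X` is `2 φ(vec X; vec M, Ω) Φ((vec B)ᵀ ω⁻¹ vec (X - M))`. The index `(j, k)` of `vec X` stands for
the position `k + n (j - 1)`, so that `vec X (j, k) = X k j` and `V ⊗ₖ Σ` is the scale matrix. -/
def matrixSkewNormal (M : Matrix (Fin n) (Fin p) ℝ) (Ω : Matrix (Fin p × Fin n) (Fin p × Fin n) ℝ)
    (B : Matrix (Fin n) (Fin p) ℝ) : Measure (Matrix (Fin n) (Fin p) ℝ) :=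
  (volume : Measure (Matrix (Fin n) (Fin p) ℝ)).withDensity fun X =>
    ENNReal.ofReal (skewNormalPDF M.vec Ω B.vec X.vec)

/-- The partial derivative `∂f/∂x_kj` at `X`. -/
def partialDeriv (k : Fin n) (j : Fin p) (f : Matrix (Fin n) (Fin p) ℝ → ℝ)
    (X : Matrix (Fin n) (Fin p) ℝ) : ℝ :=
  lineDeriv ℝ f X (Matrix.single k j 1)

/-- The matrix `X` with its entry `x_li` replaced by `t`. -/
def updateEntry (X : Matrix (Fin n) (Fin p) ℝ) (l : Fin n) (i : Fin p) (t : ℝ) :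
    Matrix (Fin n) (Fin p) ℝ :=
  X.updateRow l (Function.update (X l) i t)

/-- `g(X) → 0` as `x_li → ±∞`, for every entry `x_li` and all values of the other entries. -/
def VanishesAtInfinity (g : Matrix (Fin n) (Fin p) ℝ → ℝ) : Prop :=
  ∀ (X : Matrix (Fin n) (Fin p) ℝ) (l : Fin n) (i : Fin p),
    Tendsto (fun t : ℝ => g (updateEntry X l i t)) atTop (𝓝 0) ∧
    Tendsto (fun t : ℝ => g (updateEntry X l i t)) atBot (𝓝 0)

/-- The three boundary conditions on `f` relative to a density `φ`: the functions `f φ`,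
`f ∂φ/∂x_kj` and `φ ∂f/∂x_kj` tend to zero as any entry of the argument tends to `±∞`. -/
def BoundaryCondition (f φ : Matrix (Fin n) (Fin p) ℝ → ℝ) : Prop :=
  VanishesAtInfinity (fun X => f X * φ X) ∧
  (∀ (k : Fin n) (j : Fin p), VanishesAtInfinity fun X => f X * partialDeriv k j φ X) ∧
  (∀ (k : Fin n) (j : Fin p), VanishesAtInfinity fun X => φ X * partialDeriv k j f X)

/-- The density of `SN_{n × p}(M, Ω, *, δ)`, with the skewness given through `δ`. -/
def deltaSkewNormalPDF (M : Matrix (Fin n) (Fin p) ℝ)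
    (Ω : Matrix (Fin p × Fin n) (Fin p × Fin n) ℝ) (δ : Fin p × Fin n → ℝ)
    (X : Matrix (Fin n) (Fin p) ℝ) : ℝ :=
  skewNormalPDF M.vec Ω (alphaOfDelta Ω δ) X.vec

/-- The density of the matrix variate normal distribution with mean `M` and covariance
`Ω - δ δᵀ`. -/
def reducedNormalPDF (M : Matrix (Fin n) (Fin p) ℝ)
    (Ω : Matrix (Fin p × Fin n) (Fin p × Fin n) ℝ) (δ : Fin p × Fin n → ℝ)
    (X : Matrix (Fin n) (Fin p) ℝ) : ℝ :=
  normalPDF M.vec (Ω - Matrix.vecMulVec δ δ) X.vec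

end MatrixVariate

end SkewNormal

end

/-! The skew-normal law with parameters `Ω`, `δ` and location zero is the law of `Z` given `U > 0`,
where `(U, Z)` is centred normal with covariance `jointCov δ Ω`, whose corner entry is `1`. So `E
f(X)` is, up to a factor depending only on the dimension, an integral of `f(M + z)` against a
Gaussian density over the half space `u > 0`. Replacing `M` by `M'` is a pointwise comparison, since
`f` is nondecreasing along `M' - M`. What remains is to change the joint covariance, along the
segment from `A` to `B`.

Along this segment the Gaussian density solves a heat equation: its derivative is half the
contraction of `B - A` with its Hessian. The difference `B - A` has corner zero, border `d = δ' - δ`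
and block `Δ = Ω' - Ω`. The block term is nonnegative after moving two derivatives onto `f`, by the
first condition. The border term integrates in `u` to minus a boundary term on `u = 0`, and moving
one derivative onto `f` gives it the right sign by the third condition.

Two analytic obstacles shape the proof. To avoid any growth control at infinity, `exp (-s / 2)` is
replaced by the compactly supported generators `(1 - s / (2N))₊ᴺ`. An elliptical density still obeys
a heat equation, with the Hessian taken of another radial function `G`, where `G' = -h / 2`
(`hasDerivAt_elliptic`, `RadialProfile.half_sum_hess`). The limit in `N` is by domination, as these
generators lie below the exponential.

The second derivatives of `f` exist but may fail to be locally integrable, so Lebesgue integration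
by parts is not at hand. A gauge-type integral, which integrates every divergence of a
differentiable field, replaces it in `integral_nonpos_of_le_divergence_fin`; only continuous
functions are then integrated in the Lebesgue sense. -/

namespace SkewNormal

/-! ### Divergence comparison without integrability -/

/-- A compactly supported continuous function on `ℝᵐ⁺¹` that lies below the divergence of a
compactly supported, everywhere differentiable vector field has nonpositive integral. No
integrability of the divergence is needed. -/
theorem integral_nonpos_of_le_divergence_fin {m : ℕ}
    (v : Fin (m + 1) → (Fin (m + 1) → ℝ) → ℝ) (hv : ∀ a, Differentiable ℝ (v a))
    (hvs : ∀ a, HasCompactSupport (v a)) (c : (Fin (m + 1) → ℝ) → ℝ) (hc : Continuous c)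
    (hcs : HasCompactSupport c)
    (hle : ∀ x, c x ≤ ∑ a, fderiv ℝ (v a) x (Pi.single a 1)) :
    ∫ x, c x ≤ 0 := by
  obtain ⟨R, hR0, hR⟩ : ∃ R : ℝ, 0 < R ∧ ∀ x : Fin (m + 1) → ℝ, R ≤ ‖x‖ →
      (∀ a, v a x = 0) ∧ c x = 0 := by
    have hK : IsCompact (tsupport c ∪ ⋃ a, tsupport (v a)) :=
      hcs.isCompact.union (isCompact_iUnion fun a => (hvs a).isCompact)
    obtain ⟨r, hr⟩ := hK.isBounded.subset_ball 0
    refine ⟨max r 1, by positivity, fun x hx => ?_⟩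
    have hx' : x ∉ Metric.ball (0 : Fin (m + 1) → ℝ) r := by
      simpa using (le_max_left r 1).trans hx
    refine ⟨fun a => image_eq_zero_of_notMem_tsupport fun h => hx' (hr ?_),
      image_eq_zero_of_notMem_tsupport fun h => hx' (hr (Or.inl h))⟩
    exact Or.inr (mem_iUnion.2 ⟨a, h⟩)
  let I : BoxIntegral.Box (Fin (m + 1)) := ⟨fun _ => -R, fun _ => R, fun _ => by linarith⟩
  -- The `GP` integral of the divergence exists for merely differentiable fields. The fields vanish
  -- on the faces of the box, so its value is zero.
  have hdiv := BoxIntegral.hasIntegral_GP_divergence_of_forall_hasDerivWithinAt I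
    (fun x a => v a x) (fun x => ContinuousLinearMap.pi fun a => fderiv ℝ (v a) x) ∅
    countable_empty (by simp)
    (fun x _ => (hasFDerivAt_pi.2 fun a => (hv a x).hasFDerivAt).hasFDerivWithinAt)
  have hface : ∀ (a : Fin (m + 1)) (t : ℝ), |t| = R → ∀ y : Fin m → ℝ,
      v a (a.insertNth t y) = 0 := fun a t ht y => by
    refine (hR _ ?_).1 a
    calc R = ‖(a.insertNth t y : Fin (m + 1) → ℝ) a‖ := by simp [ht]
      _ ≤ _ := norm_le_pi_norm _ a
  have hzero : (∑ i, (BoxIntegral.integral (I.face i) BoxIntegral.IntegrationParams.GP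
      (fun x => v i (i.insertNth (I.upper i) x)) BoxIntegral.BoxAdditiveMap.volume -
      BoxIntegral.integral (I.face i) BoxIntegral.IntegrationParams.GP
      (fun x => v i (i.insertNth (I.lower i) x)) BoxIntegral.BoxAdditiveMap.volume)) = (0 : ℝ) := by
    refine Finset.sum_eq_zero fun i _ => ?_
    have h1 : (fun x => v i (i.insertNth (I.upper i) x)) = fun _ => 0 :=
      funext fun y => hface i R (abs_of_pos hR0) y
    have h2 : (fun x => v i (i.insertNth (I.lower i) x)) = fun _ => 0 :=
      funext fun y => hface i (-R) (by rw [abs_neg, abs_of_pos hR0]) y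
    rw [h1, h2, sub_self]
  have hci := hc.continuousOn.hasBoxIntegral (I := I) volume BoxIntegral.IntegrationParams.GP
  have hsub := hdiv.sub hci
  -- The comparison takes place in the `GP` integral; only the continuous `c` is converted back to a
  -- Lebesgue integral.
  have hpos := BoxIntegral.integral_nonneg (I := I) (l := BoxIntegral.IntegrationParams.GP)
    (g := (fun x => ∑ i, (ContinuousLinearMap.pi (fun a => fderiv ℝ (v a) x) :
      (Fin (m + 1) → ℝ) →L[ℝ] (Fin (m + 1) → ℝ)) (Pi.single i 1) i) - c)
    (fun x _ => by simpa using hle x) volume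
  have hint : ∫ x in (I : Set (Fin (m + 1) → ℝ)), c x = ∫ x, c x := by
    refine setIntegral_eq_integral_of_forall_compl_eq_zero fun x hx => (hR x ?_).2
    by_contra hlt
    refine hx (I.mem_coe.2 fun i => ?_)
    have := (norm_le_pi_norm x i).trans_lt (not_le.1 hlt)
    rw [Real.norm_eq_abs, abs_lt] at this
    exact ⟨this.1, this.2.le⟩
  have := hsub.integral_eq
  rw [hzero, hint] at this
  linarith [hpos.trans_eq this]

/-- The divergence comparison `integral_nonpos_of_le_divergence_fin` on a general finite
coordinate space. -/
theorem integral_nonpos_of_le_divergence {ι : Type*} [Fintype ι] [DecidableEq ι]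
    (v : ι → (ι → ℝ) → ℝ) (hv : ∀ a, Differentiable ℝ (v a))
    (hvs : ∀ a, HasCompactSupport (v a)) (c : (ι → ℝ) → ℝ) (hc : Continuous c)
    (hcs : HasCompactSupport c)
    (hle : ∀ x, c x ≤ ∑ a, fderiv ℝ (v a) x (Pi.single a 1)) :
    ∫ x, c x ≤ 0 := by
  rcases isEmpty_or_nonempty ι with hι | hι
  · exact integral_nonpos fun x => (hle x).trans (by simp)
  obtain ⟨m, hm⟩ : ∃ m, Fintype.card ι = m + 1 :=
    Nat.exists_eq_succ_of_ne_zero Fintype.card_ne_zero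
  let e : ι ≃ Fin (m + 1) := Fintype.equivFinOfCardEq hm
  let T : (Fin (m + 1) → ℝ) ≃L[ℝ] (ι → ℝ) := ContinuousLinearEquiv.piCongrLeft ℝ (fun _ => ℝ) e.symm
  have hT : ∀ x i, T x i = x (e i) := fun x i => by
    obtain ⟨j, rfl⟩ := e.symm.surjective i
    rw [e.apply_symm_apply]
    exact Equiv.piCongrLeft_apply_apply (fun _ => ℝ) e.symm x j
  have hTs : ∀ a, T (Pi.single (e a) 1) = Pi.single a 1 := fun a => by
    ext i
    rw [hT]
    simp [Pi.single_apply]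
  have hmp : MeasurePreserving T := volume_measurePreserving_piCongrLeft (fun _ => ℝ) e.symm
  rw [← hmp.integral_comp T.toHomeomorph.measurableEmbedding]
  refine integral_nonpos_of_le_divergence_fin (fun a x => v (e.symm a) (T x))
    (fun a => (hv _).comp T.differentiable) (fun a => (hvs _).comp_homeomorph T.toHomeomorph) _
    (hc.comp T.continuous) (hcs.comp_homeomorph T.toHomeomorph) fun x => (hle _).trans_eq ?_
  rw [← e.sum_comp]
  refine Finset.sum_congr rfl fun a _ => ?_
  have : fderiv ℝ (fun x => v (e.symm (e a)) (T x)) x =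
      (fderiv ℝ (v a) (T x)).comp (T : (Fin (m + 1) → ℝ) →L[ℝ] (ι → ℝ)) := by
    rw [e.symm_apply_apply]
    exact ((hv a (T x)).hasFDerivAt.comp x T.hasFDerivAt).fderiv
  rw [this]
  simp [hTs]

/-! ### Quadratic forms and determinants along affine paths of matrices -/

theorem isUnit_det_of_posDef {κ : Type*} [Fintype κ] [DecidableEq κ]
    {A : Matrix κ κ ℝ} (hA : A.PosDef) : IsUnit A.det :=
  hA.det_pos.ne'.isUnit

theorem dotProduct_mulVec_comm_of_isSymm {κ : Type*} [Fintype κ]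
    {W : Matrix κ κ ℝ} (hW : W.IsSymm) (x y : κ → ℝ) :
    x ⬝ᵥ (W *ᵥ y) = y ⬝ᵥ (W *ᵥ x) := by
  rw [dotProduct_mulVec, ← mulVec_transpose, hW.eq, dotProduct_comm]

theorem isSymm_of_posDef {κ : Type*}
    {A : Matrix κ κ ℝ} (hA : A.PosDef) : A.IsSymm := by
  have := hA.isHermitian
  rwa [Matrix.IsHermitian, conjTranspose_eq_transpose_of_trivial] at this

theorem dotProduct_inv_mulVec_nonneg {κ : Type*} [Fintype κ] [DecidableEq κ]
    {A : Matrix κ κ ℝ} (hA : A.PosDef) (x : κ → ℝ) :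
    0 ≤ x ⬝ᵥ (A⁻¹ *ᵥ x) := by
  simpa using hA.inv.posSemidef.dotProduct_mulVec_nonneg x

/-- Cauchy–Schwarz for the inverse quadratic form of a positive definite matrix. -/
theorem sq_le_diag_mul_quadForm_inv {κ : Type*} [Fintype κ] [DecidableEq κ]
    {A : Matrix κ κ ℝ} (hA : A.PosDef) (x : κ → ℝ) (a : κ) :
    x a ^ 2 ≤ A a a * (x ⬝ᵥ (A⁻¹ *ᵥ x)) := by
  have hd : 0 < A a a := hA.diag_pos
  set y := A⁻¹ *ᵥ x with hy
  have hAy : A *ᵥ y = x := by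
    rw [hy, mulVec_mulVec, mul_nonsing_inv _ (isUnit_det_of_posDef hA), one_mulVec]
  -- With `y = A⁻¹ x`, the form `A` at this vector equals `A a a * (A a a * (x ⬝ᵥ y) - x a ^ 2)`.
  have h := hA.posSemidef.dotProduct_mulVec_nonneg (A a a • y - x a • Pi.single a 1)
  have h1 : (Pi.single a 1 : κ → ℝ) ⬝ᵥ (A *ᵥ Pi.single a 1) = A a a := by simp
  have h2 : (Pi.single a 1 : κ → ℝ) ⬝ᵥ (A *ᵥ y) = x a := by simp [hAy]
  have h3 : y ⬝ᵥ (A *ᵥ Pi.single a 1) = x a := by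
    rw [dotProduct_mulVec_comm_of_isSymm (isSymm_of_posDef hA), h2]
  have h4 : y ⬝ᵥ (A *ᵥ y) = x ⬝ᵥ y := by rw [hAy, dotProduct_comm]
  rw [star_trivial] at h
  simp only [mulVec_sub, mulVec_smul, sub_dotProduct, dotProduct_sub, smul_dotProduct,
    dotProduct_smul, h1, h2, h3, h4, smul_eq_mul] at h
  have : 0 ≤ A a a * (A a a * (x ⬝ᵥ y) - x a ^ 2) := by nlinarith
  nlinarith [nonneg_of_mul_nonneg_right this hd]

theorem inv_sub_inv_of_isUnit_det {κ : Type*} [Fintype κ] [DecidableEq κ]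
    {A B : Matrix κ κ ℝ} (hA : IsUnit A.det) (hB : IsUnit B.det) :
    B⁻¹ - A⁻¹ = -(B⁻¹ * (B - A) * A⁻¹) := by
  rw [Matrix.mul_sub, Matrix.sub_mul, nonsing_inv_mul _ hB, Matrix.mul_assoc,
    mul_nonsing_inv _ hA]
  simp

theorem continuousAt_inv_of_isUnit_det {κ : Type*} [Fintype κ] [DecidableEq κ]
    {A : Matrix κ κ ℝ} (hA : IsUnit A.det) :
    ContinuousAt (fun B : Matrix κ κ ℝ => B⁻¹) A := by
  refine continuousAt_matrix_inv A ?_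
  rw [Ring.inverse_eq_inv']
  exact continuousAt_inv₀ hA.ne_zero

theorem continuous_add_smul {κ : Type*}
    (A D : Matrix κ κ ℝ) : Continuous fun t : ℝ => A + t • D := by
  fun_prop

/-- The derivative of the inverse quadratic form along an affine path of matrices. -/
theorem hasDerivAt_quadForm_inv {κ : Type*} [Fintype κ] [DecidableEq κ]
    (A D : Matrix κ κ ℝ) (x : κ → ℝ) (t : ℝ)
    (hsymm : (A + t • D).IsSymm) (ht : IsUnit (A + t • D).det) :
    HasDerivAt (fun s : ℝ => x ⬝ᵥ ((A + s • D)⁻¹ *ᵥ x))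
      (-(((A + t • D)⁻¹ *ᵥ x) ⬝ᵥ (D *ᵥ ((A + t • D)⁻¹ *ᵥ x)))) t := by
  have hc := (continuous_add_smul A D).continuousAt (x := t)
  have hinv : ContinuousAt (fun s : ℝ => (A + s • D)⁻¹) t :=
    ContinuousAt.comp (f := fun s : ℝ => A + s • D) (continuousAt_inv_of_isUnit_det ht) hc
  have hdet : ∀ᶠ s in 𝓝 t, IsUnit (A + s • D).det := by
    have : ContinuousAt (fun s : ℝ => (A + s • D).det) t :=
      (continuous_add_smul A D).matrix_det.continuousAt
    filter_upwards [this.eventually_ne ht.ne_zero] with s hs using hs.isUnit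
  rw [hasDerivAt_iff_tendsto_slope]
  -- By the resolvent identity this function is exactly the difference quotient for `s ≠ t`, so
  -- continuity of inversion suffices.
  have hlim : Tendsto (fun s : ℝ => -(x ⬝ᵥ ((A + s • D)⁻¹ *ᵥ (D *ᵥ ((A + t • D)⁻¹ *ᵥ x))))) (𝓝 t)
      (𝓝 (-(x ⬝ᵥ ((A + t • D)⁻¹ *ᵥ (D *ᵥ ((A + t • D)⁻¹ *ᵥ x)))))) := by
    have h : Continuous fun W : Matrix κ κ ℝ =>
        -(x ⬝ᵥ (W *ᵥ (D *ᵥ ((A + t • D)⁻¹ *ᵥ x)))) := by fun_prop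
    exact h.continuousAt.tendsto.comp hinv
  have hval : -(x ⬝ᵥ ((A + t • D)⁻¹ *ᵥ (D *ᵥ ((A + t • D)⁻¹ *ᵥ x)))) =
      -(((A + t • D)⁻¹ *ᵥ x) ⬝ᵥ (D *ᵥ ((A + t • D)⁻¹ *ᵥ x))) := by
    have hs : ((A + t • D)⁻¹).IsSymm := by
      rw [Matrix.IsSymm, transpose_nonsing_inv, hsymm.eq]
    rw [dotProduct_mulVec_comm_of_isSymm hs, dotProduct_comm]
  rw [hval] at hlim
  refine (hlim.mono_left nhdsWithin_le_nhds).congr' ?_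
  filter_upwards [nhdsWithin_le_nhds hdet, self_mem_nhdsWithin] with s hs hst
  have hst' : s - t ≠ 0 := sub_ne_zero.2 hst
  have hsub : (A + s • D) - (A + t • D) = (s - t) • D := by rw [sub_smul]; abel
  have hdiff := inv_sub_inv_of_isUnit_det ht hs
  rw [hsub] at hdiff
  rw [slope_def_field, ← dotProduct_sub, ← sub_mulVec, hdiff]
  simp only [Matrix.mul_smul, Matrix.smul_mul, neg_mulVec, smul_mulVec, dotProduct_neg,
    dotProduct_smul, smul_eq_mul, mulVec_mulVec, Matrix.mul_assoc]
  field_simp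

/-- Jacobi's formula along an affine path of matrices. -/
theorem hasDerivAt_det_add_smul {κ : Type*} [Fintype κ] [DecidableEq κ]
    (A D : Matrix κ κ ℝ) (t : ℝ) (ht : IsUnit (A + t • D).det) :
    HasDerivAt (fun s : ℝ => (A + s • D).det)
      ((A + t • D).det * ((A + t • D)⁻¹ * D).trace) t := by
  set B := A + t • D with hB
  obtain ⟨q, hq⟩ : ∃ q : Polynomial ℝ, ∀ r : ℝ,
      (1 + r • (B⁻¹ * D)).det = 1 + (B⁻¹ * D).trace * r + q.eval r * r ^ 2 :=
    ⟨_, fun r => det_one_add_smul r (B⁻¹ * D)⟩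
  have hfun : (fun s : ℝ => (A + s • D).det) = fun s : ℝ =>
      B.det * (1 + (B⁻¹ * D).trace * (s - t) + q.eval (s - t) * (s - t) ^ 2) := by
    funext s
    rw [← hq, ← det_mul]
    congr 1
    rw [Matrix.mul_add, Matrix.mul_one, Matrix.mul_smul, ← Matrix.mul_assoc, mul_nonsing_inv _ ht,
      Matrix.one_mul, hB, sub_smul]
    abel
  rw [hfun]
  have h1 : HasDerivAt (fun s : ℝ => s - t) 1 t := (hasDerivAt_id t).sub_const t
  have h2 : HasDerivAt (fun s : ℝ => q.eval (s - t)) _ t :=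
    HasDerivAt.comp (h₂ := fun r => q.eval r) t (q.hasDerivAt (t - t)) h1
  have h3 := (((h1.const_mul (B⁻¹ * D).trace).const_add 1).add (h2.mul (h1.pow 2))).const_mul B.det
  convert! h3 using 1
  simp

/-- The derivative of an elliptical density along an affine path of scale matrices. -/
theorem hasDerivAt_elliptic {κ : Type*} [Fintype κ] [DecidableEq κ]
    (A D : Matrix κ κ ℝ) (x : κ → ℝ) (t : ℝ)
    (ht : (A + t • D).PosDef) {h h' : ℝ → ℝ} (hh : ∀ s, HasDerivAt h (h' s) s) :
    HasDerivAt (fun s : ℝ => (√(A + s • D).det)⁻¹ * h (x ⬝ᵥ ((A + s • D)⁻¹ *ᵥ x)))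
      ((√(A + t • D).det)⁻¹ * (-(1 / 2) * (((A + t • D)⁻¹ * D).trace *
          h (x ⬝ᵥ ((A + t • D)⁻¹ *ᵥ x))) -
        h' (x ⬝ᵥ ((A + t • D)⁻¹ *ᵥ x)) *
          (((A + t • D)⁻¹ *ᵥ x) ⬝ᵥ (D *ᵥ ((A + t • D)⁻¹ *ᵥ x))))) t := by
  have hu := isUnit_det_of_posDef ht
  have hd := hasDerivAt_det_add_smul A D t hu
  have hq := hasDerivAt_quadForm_inv A D x t (isSymm_of_posDef ht) hu
  have hs := (hd.sqrt ht.det_pos.ne').inv (Real.sqrt_ne_zero'.2 ht.det_pos)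
  have hp := hs.mul ((hh _).comp t hq)
  convert! hp using 1
  have h0 : √(A + t • D).det ≠ 0 := Real.sqrt_ne_zero'.2 ht.det_pos
  have h1 : √(A + t • D).det ^ 2 = (A + t • D).det := Real.sq_sqrt ht.det_pos.le
  simp only [Function.comp, Pi.inv_apply]
  rw [h1]
  have h2 : (A + t • D).det ≠ 0 := ht.det_pos.ne'
  field_simp
  ring

/-! ### Derivatives of radial functions along lines -/

theorem hasDerivAt_quadForm_line {κ : Type*} [Fintype κ]
    {W : Matrix κ κ ℝ} (hW : W.IsSymm) (x v : κ → ℝ) :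
    HasDerivAt (fun t : ℝ => (x + t • v) ⬝ᵥ (W *ᵥ (x + t • v))) (2 * (v ⬝ᵥ (W *ᵥ x))) 0 := by
  have hfun : (fun t : ℝ => (x + t • v) ⬝ᵥ (W *ᵥ (x + t • v))) = fun t : ℝ =>
      x ⬝ᵥ (W *ᵥ x) + t * (2 * (v ⬝ᵥ (W *ᵥ x))) + t ^ 2 * (v ⬝ᵥ (W *ᵥ v)) := by
    funext t
    simp only [mulVec_add, mulVec_smul, add_dotProduct, dotProduct_add, smul_dotProduct,
      dotProduct_smul, smul_eq_mul, dotProduct_mulVec_comm_of_isSymm hW x v]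
    ring
  rw [hfun]
  have h1 := ((hasDerivAt_id (0 : ℝ)).mul_const (2 * (v ⬝ᵥ (W *ᵥ x)))).const_add (x ⬝ᵥ (W *ᵥ x))
  have h2 := ((hasDerivAt_id (0 : ℝ)).pow 2).mul_const (v ⬝ᵥ (W *ᵥ v))
  convert! h1.add h2 using 1
  simp

theorem hasDerivAt_comp_quadForm_line {κ : Type*} [Fintype κ]
    {W : Matrix κ κ ℝ} (hW : W.IsSymm) {G h : ℝ → ℝ}
    (hG : ∀ s, HasDerivAt G (-(1 / 2) * h s) s) (x v : κ → ℝ) :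
    HasDerivAt (fun t : ℝ => G ((x + t • v) ⬝ᵥ (W *ᵥ (x + t • v))))
      (-h (x ⬝ᵥ (W *ᵥ x)) * (v ⬝ᵥ (W *ᵥ x))) 0 := by
  have h1 := hasDerivAt_quadForm_line hW x v
  have h2 := HasDerivAt.comp (0 : ℝ) (hG _) h1
  convert! h2 using 1
  simp only [zero_smul, add_zero]
  ring

theorem hasDerivAt_grad_quadForm_line {κ : Type*} [Fintype κ]
    {W : Matrix κ κ ℝ} (hW : W.IsSymm) {h h' : ℝ → ℝ}
    (hh : ∀ s, HasDerivAt h (h' s) s) (x v : κ → ℝ) (a : κ) :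
    HasDerivAt (fun t : ℝ => -h ((x + t • v) ⬝ᵥ (W *ᵥ (x + t • v))) * (W *ᵥ (x + t • v)) a)
      (-2 * h' (x ⬝ᵥ (W *ᵥ x)) * (v ⬝ᵥ (W *ᵥ x)) * (W *ᵥ x) a -
        h (x ⬝ᵥ (W *ᵥ x)) * (W *ᵥ v) a) 0 := by
  have h1 := hasDerivAt_quadForm_line hW x v
  have h2 := HasDerivAt.comp (0 : ℝ) (hh _) h1
  have h3 : HasDerivAt (fun t : ℝ => (W *ᵥ (x + t • v)) a) ((W *ᵥ v) a) 0 := by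
    have : (fun t : ℝ => (W *ᵥ (x + t • v)) a) = fun t : ℝ => (W *ᵥ x) a + t * (W *ᵥ v) a := by
      funext t
      simp [mulVec_add, mulVec_smul]
    rw [this]
    simpa using ((hasDerivAt_id (0 : ℝ)).mul_const ((W *ᵥ v) a)).const_add ((W *ᵥ x) a)
  convert! h2.neg.mul h3 using 1
  simp only [zero_smul, add_zero, Pi.neg_apply, Function.comp]
  ring

/-! ### Differential inequalities in the sense of distributions -/

/-- A twice differentiable function with `Δ : ∇²g ≥ 0` pointwise satisfies the inequality in the
sense of distributions. The second derivatives of `g` need not be locally integrable. -/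
theorem integral_mul_hessian_nonneg {ι : Type*} [Fintype ι] [DecidableEq ι] {Δ : Matrix ι ι ℝ}
    (hΔ : Δ.IsSymm) {g : (ι → ℝ) → ℝ} (hg : Differentiable ℝ g) {g1 : ι → (ι → ℝ) → ℝ}
    (hg1 : ∀ b, Differentiable ℝ (g1 b)) (hgg1 : ∀ a z, fderiv ℝ g z (Pi.single a 1) = g1 a z)
    (hpos : ∀ z, 0 ≤ ∑ a, ∑ b, Δ a b * fderiv ℝ (g1 b) z (Pi.single a 1))
    {η : (ι → ℝ) → ℝ} (hη : Differentiable ℝ η) {η1 : ι → (ι → ℝ) → ℝ}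
    (hη1 : ∀ b, Differentiable ℝ (η1 b)) (hηη1 : ∀ a z, fderiv ℝ η z (Pi.single a 1) = η1 a z)
    {η2 : ι → ι → (ι → ℝ) → ℝ}
    (hηη2 : ∀ a b z, fderiv ℝ (η1 b) z (Pi.single a 1) = η2 a b z)
    (hη2 : ∀ a b, Continuous (η2 a b)) (hη0 : ∀ z, 0 ≤ η z) (hηs : HasCompactSupport η) :
    0 ≤ ∫ z, g z * ∑ a, ∑ b, Δ a b * η2 a b z := by
  have hη1s : ∀ a, HasCompactSupport (η1 a) := fun a => by
    have := hηs.fderiv_apply ℝ (Pi.single a 1)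
    simpa only [hηη1] using this
  have hη2s : ∀ a b, HasCompactSupport (η2 a b) := fun a b => by
    have := (hη1s b).fderiv_apply ℝ (Pi.single a 1)
    simpa only [hηη2] using this
  set K := tsupport η ∪ ((⋃ a, tsupport (η1 a)) ∪ ⋃ a, ⋃ b, tsupport (η2 a b)) with hK
  have hKc : IsCompact K :=
    hηs.isCompact.union ((isCompact_iUnion fun a => (hη1s a).isCompact).union
    (isCompact_iUnion fun a => isCompact_iUnion fun b => (hη2s a b).isCompact))
  have h0 : ∀ z ∉ K, η z = 0 := fun z hz =>
    image_eq_zero_of_notMem_tsupport fun h => hz (Or.inl h)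
  have h1 : ∀ z ∉ K, ∀ a, η1 a z = 0 := fun z hz a =>
    image_eq_zero_of_notMem_tsupport fun h => hz (Or.inr (Or.inl (mem_iUnion.2 ⟨a, h⟩)))
  have h2 : ∀ z ∉ K, ∀ a b, η2 a b z = 0 := fun z hz a b =>
    image_eq_zero_of_notMem_tsupport fun h => hz (Or.inr (Or.inr (mem_iUnion₂.2 ⟨a, b, h⟩)))
  have hgc : Continuous g := hg.continuous
  -- Green's second identity: this field has divergence `η Δ : ∇²g - g Δ : ∇²η`, whose first term is
  -- nonnegative and whose second is continuous.
  have key := integral_nonpos_of_le_divergence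
    (fun a z => η z * ∑ b, Δ a b * g1 b z - g z * ∑ b, Δ a b * η1 b z)
    (fun a => by fun_prop)
    (fun a => HasCompactSupport.intro hKc fun z hz => by simp [h0 z hz, h1 z hz])
    (fun z => -(g z * ∑ a, ∑ b, Δ a b * η2 a b z))
    (by fun_prop) (HasCompactSupport.intro hKc fun z hz => by simp [h2 z hz]) fun z => ?_
  · rw [integral_neg] at key
    linarith
  have hderiv : ∀ a, fderiv ℝ
      (fun z => η z * ∑ b, Δ a b * g1 b z - g z * ∑ b, Δ a b * η1 b z) z (Pi.single a 1) =
      (η z * ∑ b, Δ a b * fderiv ℝ (g1 b) z (Pi.single a 1) + η1 a z * ∑ b, Δ a b * g1 b z) -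
        (g z * ∑ b, Δ a b * η2 a b z + g1 a z * ∑ b, Δ a b * η1 b z) := by
    intro a
    have h1 : HasFDerivAt (fun z => ∑ b, Δ a b * g1 b z) (∑ b, Δ a b • fderiv ℝ (g1 b) z) z :=
      HasFDerivAt.fun_sum fun b _ => (hg1 b z).hasFDerivAt.const_mul (Δ a b)
    have h2 : HasFDerivAt (fun z => ∑ b, Δ a b * η1 b z) (∑ b, Δ a b • fderiv ℝ (η1 b) z) z :=
      HasFDerivAt.fun_sum fun b _ => (hη1 b z).hasFDerivAt.const_mul (Δ a b)
    rw [(((hη z).hasFDerivAt.fun_mul h1).fun_sub ((hg z).hasFDerivAt.fun_mul h2)).fderiv]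
    simp only [_root_.sub_apply, _root_.add_apply,
      _root_.smul_apply, _root_.sum_apply, smul_eq_mul, hgg1, hηη1, hηη2]
    ring
  rw [Finset.sum_congr rfl fun a _ => hderiv a]
  simp only [Finset.sum_sub_distrib, Finset.sum_add_distrib]
  -- The first-order cross terms cancel because `Δ` is symmetric.
  have hsw : ∑ a, η1 a z * ∑ b, Δ a b * g1 b z = ∑ a, g1 a z * ∑ b, Δ a b * η1 b z := by
    simp only [Finset.mul_sum]
    rw [Finset.sum_comm]
    refine Finset.sum_congr rfl fun a _ => Finset.sum_congr rfl fun b _ => ?_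
    rw [hΔ.apply a b]
    ring
  have h3 : 0 ≤ η z * ∑ a, ∑ b, Δ a b * fderiv ℝ (g1 b) z (Pi.single a 1) :=
    mul_nonneg (hη0 z) (hpos z)
  rw [hsw]
  simp only [← Finset.mul_sum]
  linarith

/-- If `g` is nondecreasing in the direction `d`, then its distributional derivative in this
direction is nonnegative. -/
theorem integral_mul_lineDeriv_nonpos {ι : Type*} [Fintype ι] [DecidableEq ι] {d : ι → ℝ}
    {g : (ι → ℝ) → ℝ} (hg : Differentiable ℝ g) {g1 : ι → (ι → ℝ) → ℝ}
    (hgg1 : ∀ a z, fderiv ℝ g z (Pi.single a 1) = g1 a z)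
    (hpos : ∀ z, 0 ≤ ∑ a, d a * g1 a z)
    {η : (ι → ℝ) → ℝ} (hη : Differentiable ℝ η) {η1 : ι → (ι → ℝ) → ℝ}
    (hη1 : ∀ b, Continuous (η1 b)) (hηη1 : ∀ a z, fderiv ℝ η z (Pi.single a 1) = η1 a z)
    (hη0 : ∀ z, 0 ≤ η z) (hηs : HasCompactSupport η) :
    ∫ z, g z * ∑ a, d a * η1 a z ≤ 0 := by
  have hη1s : ∀ a, HasCompactSupport (η1 a) := fun a => by
    have := hηs.fderiv_apply ℝ (Pi.single a 1)
    simpa only [hηη1] using this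
  have hgc : Continuous g := hg.continuous
  refine integral_nonpos_of_le_divergence (fun a z => d a * (g z * η z)) (fun a => by fun_prop)
    (fun a => (hηs.mul_left (f := g)).mul_left (f := fun _ => d a)) _ (by fun_prop) ?_ fun z => ?_
  · refine HasCompactSupport.intro (isCompact_iUnion fun a => (hη1s a).isCompact) fun z hz => ?_
    have : ∀ a, η1 a z = 0 := fun a => image_eq_zero_of_notMem_tsupport fun h =>
      hz (mem_iUnion.2 ⟨a, h⟩)
    simp [this]
  · have hderiv : ∀ a, fderiv ℝ (fun z => d a * (g z * η z)) z (Pi.single a 1) =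
        g z * (d a * η1 a z) + η z * (d a * g1 a z) := by
      intro a
      rw [(((hg z).hasFDerivAt.fun_mul (hη z).hasFDerivAt).const_mul (d a)).fderiv]
      simp only [_root_.add_apply, _root_.smul_apply, smul_eq_mul, hgg1,
        hηη1]
      ring
    rw [Finset.sum_congr rfl fun a _ => hderiv a, Finset.sum_add_distrib, ← Finset.mul_sum,
      ← Finset.mul_sum]
    linarith [mul_nonneg (hη0 z) (hpos z)]

/-! ### The augmented space and compactly supported radial profiles -/

/-- The vector `(u, z)` in `ℝ^(1 + ι)`. -/
def aug {ι : Type*} (u : ℝ) (z : ι → ℝ) : Unit ⊕ ι → ℝ := Sum.elim (fun _ => u) z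

theorem aug_add_smul_inr {ι : Type*} [DecidableEq ι] (u : ℝ) (z : ι → ℝ) (t : ℝ) (a : ι) :
    aug u (z + t • Pi.single a 1) = aug u z + t • Pi.single (Sum.inr a) 1 := by
  ext (i | i) <;> simp [aug, Pi.single_apply]

theorem aug_add_inl {ι : Type*} [DecidableEq ι] (u : ℝ) (z : ι → ℝ) (t : ℝ) :
    aug (u + t) z = aug u z + t • Pi.single (Sum.inl ()) 1 := by
  ext (i | i) <;> simp [aug]

theorem continuous_aug {ι : Type*} : Continuous fun x : ℝ × (ι → ℝ) => aug x.1 x.2 := by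
  refine continuous_pi fun i => ?_
  rcases i with i | i <;> simp only [aug, Sum.elim_inl, Sum.elim_inr] <;> fun_prop

theorem differentiable_aug {ι : Type*} [Fintype ι] (u : ℝ) :
    Differentiable ℝ fun z : ι → ℝ => aug u z := by
  refine differentiable_pi.2 fun i => ?_
  rcases i with i | i <;> simp only [aug, Sum.elim_inl, Sum.elim_inr] <;> fun_prop

theorem norm_prod_le_norm_aug {ι : Type*} [Fintype ι] (u : ℝ) (z : ι → ℝ) :
    ‖(u, z)‖ ≤ ‖aug u z‖ := by
  rw [Prod.norm_def]
  refine max_le (norm_le_pi_norm (aug u z) (Sum.inl ())) ?_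
  exact (pi_norm_le_iff_of_nonneg (norm_nonneg _)).2 fun i =>
    norm_le_pi_norm (aug u z) (Sum.inr i)

/-- The bound depends on `A` only through its diagonal, so it can be made uniform along a segment of
matrices. -/
theorem norm_le_of_quadForm_inv_le {κ : Type*} [Fintype κ] [DecidableEq κ] {A : Matrix κ κ ℝ}
    (hA : A.PosDef) {C R : ℝ} (hC : ∀ a, A a a ≤ C) {x : κ → ℝ}
    (hx : x ⬝ᵥ (A⁻¹ *ᵥ x) ≤ R) : ‖x‖ ≤ √(C * R) := by
  refine (pi_norm_le_iff_of_nonneg (Real.sqrt_nonneg _)).2 fun a => ?_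
  rw [Real.norm_eq_abs]
  refine Real.abs_le_sqrt ((sq_le_diag_mul_quadForm_inv hA x a).trans ?_)
  exact mul_le_mul (hC a) hx (dotProduct_inv_mulVec_nonneg hA x) (hA.diag_pos.le.trans (hC a))

theorem exists_forall_norm_le_of_quadForm_inv_le {κ : Type*} [Fintype κ] [DecidableEq κ]
    {A : Matrix κ κ ℝ} (hA : A.PosDef) (R : ℝ) :
    ∃ r, ∀ x : κ → ℝ, x ⬝ᵥ (A⁻¹ *ᵥ x) ≤ R → ‖x‖ ≤ r :=
  ⟨√((∑ a, A a a) * R), fun _ hx => norm_le_of_quadForm_inv_le hA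
    (fun a => Finset.single_le_sum (f := fun a => A a a) (fun _ _ => hA.diag_pos.le)
      (Finset.mem_univ a)) hx⟩

theorem fderiv_apply_eq_of_hasDerivAt_line {E : Type*} [NormedAddCommGroup E] [NormedSpace ℝ E]
    {F : E → ℝ} {z v : E} {c : ℝ} (hF : DifferentiableAt ℝ F z)
    (h : HasDerivAt (fun t : ℝ => F (z + t • v)) c 0) : fderiv ℝ F z v = c := by
  rw [← hF.lineDeriv_eq_fderiv]
  exact HasLineDerivAt.lineDeriv h

theorem integrable_halfSpace {ι : Type*} [Fintype ι] {F : ℝ × (ι → ℝ) → ℝ} (hF : Continuous F)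
    (hs : HasCompactSupport F) :
    Integrable F ((volume.restrict (Ioi (0 : ℝ))).prod (volume : Measure (ι → ℝ))) :=
  hF.integrable_of_hasCompactSupport hs

/-- A continuously differentiable generator `h ≥ 0` of an elliptical density with compact support,
together with a nonnegative `G` such that `G' = -h / 2`. -/
structure RadialProfile where
  /-- the generator -/
  h : ℝ → ℝ
  /-- its derivative -/
  h' : ℝ → ℝ
  /-- its antiderivative, up to the factor `-2` -/
  G : ℝ → ℝ
  /-- the radius (of the quadratic form) beyond which everything vanishes -/
  R : ℝ
  hasDerivAt_h : ∀ s, HasDerivAt h (h' s) s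
  hasDerivAt_G : ∀ s, HasDerivAt G (-(1 / 2) * h s) s
  continuous_h' : Continuous h'
  h_nonneg : ∀ s, 0 ≤ h s
  G_nonneg : ∀ s, 0 ≤ G s
  h_eq_zero : ∀ s, R < s → h s = 0
  h'_eq_zero : ∀ s, R < s → h' s = 0
  G_eq_zero : ∀ s, R < s → G s = 0

namespace RadialProfile

variable (P : RadialProfile)

theorem continuous_h : Continuous P.h :=
  continuous_iff_continuousAt.2 fun s => (P.hasDerivAt_h s).continuousAt

theorem differentiable_h : Differentiable ℝ P.h := fun s => (P.hasDerivAt_h s).differentiableAt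

theorem differentiable_G : Differentiable ℝ P.G := fun s => (P.hasDerivAt_G s).differentiableAt

/-- The gradient of `x ↦ G (xᵀ W x)`. -/
def grad {κ : Type*} [Fintype κ] (W : Matrix κ κ ℝ) (x : κ → ℝ) (i : κ) : ℝ :=
  -P.h (x ⬝ᵥ (W *ᵥ x)) * (W *ᵥ x) i

/-- The Hessian of `x ↦ G (xᵀ W x)`. -/
def hess {κ : Type*} [Fintype κ] (W : Matrix κ κ ℝ) (x : κ → ℝ) (i j : κ) : ℝ :=
  -2 * P.h' (x ⬝ᵥ (W *ᵥ x)) * (W *ᵥ x) i * (W *ᵥ x) j - P.h (x ⬝ᵥ (W *ᵥ x)) * W j i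

theorem hasDerivAt_grad {κ : Type*} [Fintype κ] [DecidableEq κ] {W : Matrix κ κ ℝ} (hW : W.IsSymm)
    (x : κ → ℝ) (i j : κ) :
    HasDerivAt (fun t : ℝ => P.grad W (x + t • Pi.single i 1) j) (P.hess W x i j) 0 := by
  have := hasDerivAt_grad_quadForm_line hW P.hasDerivAt_h x (Pi.single i 1) j
  simpa [grad, hess] using this

theorem hasDerivAt_comp_line {κ : Type*} [Fintype κ] [DecidableEq κ] {W : Matrix κ κ ℝ}
    (hW : W.IsSymm) (x : κ → ℝ) (i : κ) :
    HasDerivAt (fun t : ℝ => P.G ((x + t • Pi.single i 1) ⬝ᵥ (W *ᵥ (x + t • Pi.single i 1))))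
      (P.grad W x i) 0 := by
  have := hasDerivAt_comp_quadForm_line hW P.hasDerivAt_G x (Pi.single i 1)
  simpa [grad] using this

theorem differentiable_quadForm {κ : Type*} [Fintype κ] (W : Matrix κ κ ℝ) :
    Differentiable ℝ fun x : κ → ℝ => x ⬝ᵥ (W *ᵥ x) := by
  simp only [dotProduct, mulVec]
  fun_prop

theorem differentiable_grad {κ : Type*} [Fintype κ] (W : Matrix κ κ ℝ) (i : κ) :
    Differentiable ℝ fun x : κ → ℝ => P.grad W x i := by
  have h1 : Differentiable ℝ fun x : κ → ℝ => P.h (x ⬝ᵥ (W *ᵥ x)) :=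
    P.differentiable_h.comp (differentiable_quadForm W)
  have h2 : Differentiable ℝ fun x : κ → ℝ => (W *ᵥ x) i := by
    simp only [dotProduct, mulVec]
    fun_prop
  unfold grad
  fun_prop

theorem continuous_hess {κ : Type*} [Fintype κ] (W : Matrix κ κ ℝ) (i j : κ) :
    Continuous fun x : κ → ℝ => P.hess W x i j := by
  have h1 := P.continuous_h
  have h2 := P.continuous_h'
  unfold hess
  fun_prop

/-- The heat equation for elliptical densities: with `W` the inverse scale matrix, the right side
is, up to the determinant factor, the derivative in `hasDerivAt_elliptic`. The relation `G' = -h /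
2` is what makes the two agree. -/
theorem half_sum_hess {κ : Type*} [Fintype κ] (W D : Matrix κ κ ℝ) (x : κ → ℝ) :
    1 / 2 * ∑ i, ∑ j, D i j * P.hess W x i j =
      -(1 / 2) * ((W * D).trace * P.h (x ⬝ᵥ (W *ᵥ x))) -
        P.h' (x ⬝ᵥ (W *ᵥ x)) * ((W *ᵥ x) ⬝ᵥ (D *ᵥ (W *ᵥ x))) := by
  have h1 : (W * D).trace = ∑ i, ∑ j, D i j * W j i := by
    rw [trace_mul_comm]
    simp [trace, Matrix.mul_apply]
  have h2 : (W *ᵥ x) ⬝ᵥ (D *ᵥ (W *ᵥ x)) = ∑ i, ∑ j, D i j * ((W *ᵥ x) i * (W *ᵥ x) j) := by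
    simp only [dotProduct, mulVec]
    refine Finset.sum_congr rfl fun i _ => ?_
    rw [Finset.mul_sum]
    exact Finset.sum_congr rfl fun j _ => by ring
  rw [h1, h2]
  simp only [hess, Finset.mul_sum, Finset.sum_mul, ← Finset.sum_sub_distrib]
  exact Finset.sum_congr rfl fun i _ => Finset.sum_congr rfl fun j _ => by ring

end RadialProfile

/-! ### Sign of the generator on the half space -/

/-- The matrix with blocks `0`, `dᵀ`, `d` and `Δ`. -/
def bordered {ι : Type*} (d : ι → ℝ) (Δ : Matrix ι ι ℝ) : Matrix (Unit ⊕ ι) (Unit ⊕ ι) ℝ :=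
  fromBlocks 0 (replicateRow Unit d) (replicateCol Unit d) Δ

/-- Fundamental theorem of calculus in `u`: the upper boundary term vanishes by compact support,
leaving the value at `u = 0`. -/
theorem integral_Ioi_hess_eq {ι : Type*} [Fintype ι] [DecidableEq ι] (P : RadialProfile)
    {A : Matrix (Unit ⊕ ι) (Unit ⊕ ι) ℝ} (hA : A.PosDef) (z : ι → ℝ) (j : Unit ⊕ ι) :
    ∫ u in Ioi (0 : ℝ), P.hess A⁻¹ (aug u z) (Sum.inl ()) j = -P.grad A⁻¹ (aug 0 z) j := by
  have hW : (A⁻¹).IsSymm := isSymm_of_posDef hA.inv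
  obtain ⟨r, hr⟩ := exists_forall_norm_le_of_quadForm_inv_le hA P.R
  have hfar : ∀ u : ℝ, r < |u| → P.R < aug u z ⬝ᵥ (A⁻¹ *ᵥ aug u z) := by
    intro u hu
    by_contra hle
    have h1 := (norm_le_pi_norm (aug u z) (Sum.inl ())).trans (hr _ (not_lt.1 hle))
    exact absurd h1 (not_le.2 hu)
  have hcont : Continuous fun u : ℝ => P.hess A⁻¹ (aug u z) (Sum.inl ()) j :=
    (P.continuous_hess A⁻¹ (Sum.inl ()) j).comp
      (continuous_aug.comp (Continuous.prodMk_left z))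
  have hcs : HasCompactSupport fun u : ℝ => P.hess A⁻¹ (aug u z) (Sum.inl ()) j := by
    refine HasCompactSupport.intro (isCompact_closedBall (0 : ℝ) r) fun u hu => ?_
    have := hfar u (by simpa using hu)
    simp [RadialProfile.hess, P.h_eq_zero _ this, P.h'_eq_zero _ this]
  have hderiv : ∀ u : ℝ, HasDerivAt (fun u => P.grad A⁻¹ (aug u z) j)
      (P.hess A⁻¹ (aug u z) (Sum.inl ()) j) u := by
    intro u
    have := P.hasDerivAt_grad hW (aug u z) (Sum.inl ()) j
    simp only [← aug_add_inl] at this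
    have h2 := HasDerivAt.comp_sub_const (x := u) (a := u)
      (f := fun t => P.grad A⁻¹ (aug (u + t) z) j)
      (by simpa using this)
    simpa using h2
  rw [integral_Ioi_of_hasDerivAt_of_tendsto (hderiv 0).continuousAt.continuousWithinAt
    (fun u _ => hderiv u) (hcont.integrable_of_hasCompactSupport hcs).integrableOn (m := 0), zero_sub]
  refine tendsto_const_nhds.congr' ?_
  filter_upwards [eventually_gt_atTop r, eventually_ge_atTop 0] with u hu hu0
  have := hfar u (by rwa [abs_of_nonneg hu0])
  simp [RadialProfile.grad, P.h_eq_zero _ this]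

theorem exists_isCompact_aug {ι : Type*} [Fintype ι] [DecidableEq ι] (R : ℝ)
    {A : Matrix (Unit ⊕ ι) (Unit ⊕ ι) ℝ} (hA : A.PosDef) :
    ∃ K : Set (ℝ × (ι → ℝ)), IsCompact K ∧
      ∀ x ∉ K, R < aug x.1 x.2 ⬝ᵥ (A⁻¹ *ᵥ aug x.1 x.2) := by
  obtain ⟨r, hr⟩ := exists_forall_norm_le_of_quadForm_inv_le hA R
  refine ⟨Metric.closedBall 0 r, isCompact_closedBall _ _, fun x hx => ?_⟩
  by_contra hle
  exact hx (by simpa using (norm_prod_le_norm_aug x.1 x.2).trans (hr _ (not_lt.1 hle)))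

/-- The pairing of a function that is `Δ`-subharmonic and nondecreasing along `d` with the generator
`bordered d Δ : ∇²` applied to an elliptical profile, over the half space `u > 0`. -/
theorem integral_halfSpace_hess_nonneg {ι : Type*} [Fintype ι] [DecidableEq ι] (P : RadialProfile)
    {A : Matrix (Unit ⊕ ι) (Unit ⊕ ι) ℝ} (hA : A.PosDef) {d : ι → ℝ} {Δ : Matrix ι ι ℝ}
    (hΔ : Δ.IsSymm) {g : (ι → ℝ) → ℝ} (hg : Differentiable ℝ g) {g1 : ι → (ι → ℝ) → ℝ}
    (hg1 : ∀ b, Differentiable ℝ (g1 b)) (hgg1 : ∀ a z, fderiv ℝ g z (Pi.single a 1) = g1 a z)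
    (hpos : ∀ z, 0 ≤ ∑ a, ∑ b, Δ a b * fderiv ℝ (g1 b) z (Pi.single a 1))
    (hd : ∀ z, 0 ≤ ∑ a, d a * g1 a z) :
    0 ≤ ∫ x : ℝ × (ι → ℝ), g x.2 * ∑ i, ∑ j, bordered d Δ i j * P.hess A⁻¹ (aug x.1 x.2) i j
      ∂((volume.restrict (Ioi (0 : ℝ))).prod volume) := by
  have hW : (A⁻¹).IsSymm := isSymm_of_posDef hA.inv
  obtain ⟨K, hK, hKR⟩ := exists_isCompact_aug P.R hA
  have hgc : Continuous g := hg.continuous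
  have hhess : ∀ i j, Continuous fun x : ℝ × (ι → ℝ) => P.hess A⁻¹ (aug x.1 x.2) i j :=
    fun i j => (P.continuous_hess A⁻¹ i j).comp continuous_aug
  have hhess0 : ∀ x ∉ K, ∀ i j, P.hess A⁻¹ (aug x.1 x.2) i j = 0 := fun x hx i j => by
    simp [RadialProfile.hess, P.h_eq_zero _ (hKR x hx), P.h'_eq_zero _ (hKR x hx)]
  set F₁ : ℝ × (ι → ℝ) → ℝ := fun x =>
    g x.2 * ∑ a, ∑ b, Δ a b * P.hess A⁻¹ (aug x.1 x.2) (Sum.inr a) (Sum.inr b) with hF₁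
  set F₂ : ℝ × (ι → ℝ) → ℝ := fun x =>
    g x.2 * ∑ a, d a * P.hess A⁻¹ (aug x.1 x.2) (Sum.inl ()) (Sum.inr a) with hF₂
  have hi₁ : Integrable F₁ ((volume.restrict (Ioi (0 : ℝ))).prod volume) :=
    integrable_halfSpace (by fun_prop) (HasCompactSupport.intro hK fun x hx => by
      simp [hF₁, hhess0 x hx])
  have hi₂ : Integrable F₂ ((volume.restrict (Ioi (0 : ℝ))).prod volume) :=
    integrable_halfSpace (by fun_prop) (HasCompactSupport.intro hK fun x hx => by
      simp [hF₂, hhess0 x hx])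
  have hsymm : ∀ x i j, P.hess A⁻¹ x i j = P.hess A⁻¹ x j i := fun x i j => by
    simp only [RadialProfile.hess, hW.apply i j]
    ring
  -- There is no second derivative in `u` because the corner of `bordered d Δ` is zero; the factor
  -- `2` collects the two equal borders.
  have hsplit : ∀ x : ℝ × (ι → ℝ),
      g x.2 * ∑ i, ∑ j, bordered d Δ i j * P.hess A⁻¹ (aug x.1 x.2) i j =
        F₁ x + 2 * F₂ x := by
    intro x
    simp only [Fintype.sum_sum_type, bordered, fromBlocks_apply₁₁, fromBlocks_apply₁₂,
      fromBlocks_apply₂₁, fromBlocks_apply₂₂, replicateRow_apply, replicateCol_apply,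
      Finset.univ_unique, Finset.sum_singleton, Matrix.zero_apply, zero_mul, zero_add,
      Finset.sum_add_distrib, hF₁, hF₂, hsymm _ (Sum.inr _) (Sum.inl _)]
    simp only [PUnit.default_eq_unit]
    ring
  have hz : ∀ u : ℝ, Continuous fun z : ι → ℝ => aug u z := fun u =>
    (differentiable_aug u).continuous
  have hηd : ∀ u : ℝ, Differentiable ℝ fun z : ι → ℝ => P.G (aug u z ⬝ᵥ (A⁻¹ *ᵥ aug u z)) :=
    fun u => P.differentiable_G.comp
      ((RadialProfile.differentiable_quadForm A⁻¹).comp (differentiable_aug u))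
  have hη1d : ∀ (u : ℝ) (b : ι), Differentiable ℝ fun z : ι → ℝ =>
      P.grad A⁻¹ (aug u z) (Sum.inr b) :=
    fun u b => (P.differentiable_grad A⁻¹ (Sum.inr b)).comp (differentiable_aug u)
  have hηη1 : ∀ (u : ℝ) (a : ι) (z : ι → ℝ),
      fderiv ℝ (fun z : ι → ℝ => P.G (aug u z ⬝ᵥ (A⁻¹ *ᵥ aug u z))) z (Pi.single a 1) =
        P.grad A⁻¹ (aug u z) (Sum.inr a) := fun u a z => by
    refine fderiv_apply_eq_of_hasDerivAt_line (hηd u z) ?_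
    simp only [aug_add_smul_inr]
    exact P.hasDerivAt_comp_line hW (aug u z) (Sum.inr a)
  have hηη2 : ∀ (u : ℝ) (a b : ι) (z : ι → ℝ),
      fderiv ℝ (fun z : ι → ℝ => P.grad A⁻¹ (aug u z) (Sum.inr b)) z (Pi.single a 1) =
        P.hess A⁻¹ (aug u z) (Sum.inr a) (Sum.inr b) := fun u a b z => by
    refine fderiv_apply_eq_of_hasDerivAt_line (hη1d u b z) ?_
    simp only [aug_add_smul_inr]
    exact P.hasDerivAt_grad hW (aug u z) (Sum.inr a) (Sum.inr b)
  have hηs : ∀ u : ℝ, HasCompactSupport fun z : ι → ℝ => P.G (aug u z ⬝ᵥ (A⁻¹ *ᵥ aug u z)) :=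
    fun u => HasCompactSupport.intro (hK.image continuous_snd) fun z hz =>
      P.G_eq_zero _ (hKR (u, z) fun h => hz ⟨_, h, rfl⟩)
  have h₁ : 0 ≤ ∫ x, F₁ x ∂((volume.restrict (Ioi (0 : ℝ))).prod volume) := by
    rw [integral_prod _ hi₁]
    -- For each fixed `u` the slice of `G` is a nonnegative compactly supported test function in
    -- `z`.
    refine integral_nonneg fun u => ?_
    exact integral_mul_hessian_nonneg hΔ hg hg1 hgg1 hpos (hηd u) (hη1d u) (hηη1 u)
      (η2 := fun a b z => P.hess A⁻¹ (aug u z) (Sum.inr a) (Sum.inr b)) (hηη2 u)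
      (fun a b => (P.continuous_hess A⁻¹ _ _).comp (hz u)) (fun z => P.G_nonneg _) (hηs u)
  have h₂ : 0 ≤ ∫ x, F₂ x ∂((volume.restrict (Ioi (0 : ℝ))).prod volume) := by
    -- Here `u` is integrated first, which turns the mixed derivatives into a gradient on the
    -- hyperplane `u = 0`.
    rw [integral_prod_symm _ hi₂]
    have hinner : ∀ z : ι → ℝ, ∫ u in Ioi (0 : ℝ), F₂ (u, z) =
        -(g z * ∑ a, d a * P.grad A⁻¹ (aug 0 z) (Sum.inr a)) := by
      intro z
      simp only [hF₂]
      rw [integral_const_mul, integral_finsetSum]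
      · simp only [integral_const_mul, integral_Ioi_hess_eq P hA, mul_neg, Finset.sum_neg_distrib]
      · intro a _
        refine Integrable.const_mul (Integrable.restrict ?_) _
        refine ((hhess (Sum.inl ()) (Sum.inr a)).comp
          (Continuous.prodMk_left z)).integrable_of_hasCompactSupport
          (HasCompactSupport.intro (hK.image continuous_fst) fun u hu => ?_)
        exact hhess0 (u, z) (fun h => hu ⟨_, h, rfl⟩) _ _
    simp only [hinner, integral_neg]
    rw [Left.nonneg_neg_iff]
    exact integral_mul_lineDeriv_nonpos hg hgg1 hd (hηd 0)
      (fun b => (hη1d 0 b).continuous) (hηη1 0) (fun z => P.G_nonneg _) (hηs 0)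
  simp only [hsplit]
  rw [integral_add hi₁ (hi₂.const_mul 2), integral_const_mul]
  linarith

/-! ### Interpolation between two scale matrices -/

theorem posDef_add_smul_sub {κ : Type*} {A B : Matrix κ κ ℝ} (hA : A.PosDef)
    (hB : B.PosDef) {t : ℝ} (ht : t ∈ Icc (0 : ℝ) 1) : (A + t • (B - A)).PosDef := by
  have : A + t • (B - A) = (1 - t) • A + t • B := by
    rw [smul_sub, sub_smul, one_smul]
    abel
  rw [this]
  rcases ht.1.eq_or_lt with h0 | h0
  · simpa [← h0] using hA
  rcases ht.2.eq_or_lt with h1 | h1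
  · simpa [h1] using hB
  exact (hA.smul (sub_pos.2 h1)).add (hB.smul h0)

/-- The elliptical density with generator `P.h` and scale matrix `A`, up to normalization. -/
noncomputable def ellipticPDF {κ : Type*} [Fintype κ] [DecidableEq κ] (P : RadialProfile)
    (A : Matrix κ κ ℝ) (x : κ → ℝ) : ℝ :=
  (√A.det)⁻¹ * P.h (x ⬝ᵥ (A⁻¹ *ᵥ x))

theorem continuousOn_inv_path {κ : Type*} [Fintype κ] [DecidableEq κ] {A D : Matrix κ κ ℝ}
    {s : Set ℝ} (hs : ∀ t ∈ s, (A + t • D).PosDef) :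
    ContinuousOn (fun t : ℝ => (A + t • D)⁻¹) s := fun t ht =>
  (ContinuousAt.comp (f := fun t : ℝ => A + t • D)
    (continuousAt_inv_of_isUnit_det (isUnit_det_of_posDef (hs t ht)))
    (continuous_add_smul A D).continuousAt).continuousWithinAt

theorem continuousOn_inv_sqrt_det_path {κ : Type*} [Fintype κ] [DecidableEq κ]
    {A D : Matrix κ κ ℝ} {s : Set ℝ} (hs : ∀ t ∈ s, (A + t • D).PosDef) :
    ContinuousOn (fun t : ℝ => (√(A + t • D).det)⁻¹) s :=
  ((continuous_add_smul A D).matrix_det.sqrt.continuousOn).inv₀ fun t ht =>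
    Real.sqrt_ne_zero'.2 (hs t ht).det_pos

theorem ContinuousOn.aug_matrix {ι : Type*} [Fintype ι] {s : Set ℝ}
    {W : ℝ → Matrix (Unit ⊕ ι) (Unit ⊕ ι) ℝ} (hW : ContinuousOn W s)
    {Y : Type*} [TopologicalSpace Y]
    {Ψ : Matrix (Unit ⊕ ι) (Unit ⊕ ι) ℝ × (Unit ⊕ ι → ℝ) → Y} (hΨ : Continuous Ψ) :
    ContinuousOn (fun y : ℝ × (ℝ × (ι → ℝ)) => Ψ (W y.1, aug y.2.1 y.2.2)) (s ×ˢ univ) :=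
  hΨ.comp_continuousOn
    ((hW.comp continuousOn_fst fun _ hy => hy.1).prodMk
      (continuous_aug.comp continuous_snd).continuousOn)

/-- Comparison of the integrals of `g` against two compactly supported skew-elliptical densities
whose scale matrices differ by `bordered d Δ`. -/
theorem integral_ellipticPDF_mono {ι : Type*} [Fintype ι] [DecidableEq ι] (P : RadialProfile)
    {A B : Matrix (Unit ⊕ ι) (Unit ⊕ ι) ℝ} (hA : A.PosDef) (hB : B.PosDef) {d : ι → ℝ}
    {Δ : Matrix ι ι ℝ} (hAB : B - A = bordered d Δ) {g : (ι → ℝ) → ℝ} (hg : Differentiable ℝ g)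
    {g1 : ι → (ι → ℝ) → ℝ} (hg1 : ∀ b, Differentiable ℝ (g1 b))
    (hgg1 : ∀ a z, fderiv ℝ g z (Pi.single a 1) = g1 a z)
    (hpos : ∀ z, 0 ≤ ∑ a, ∑ b, Δ a b * fderiv ℝ (g1 b) z (Pi.single a 1))
    (hd : ∀ z, 0 ≤ ∑ a, d a * g1 a z) :
    ∫ x : ℝ × (ι → ℝ), g x.2 * ellipticPDF P A (aug x.1 x.2)
        ∂((volume.restrict (Ioi (0 : ℝ))).prod volume) ≤
      ∫ x : ℝ × (ι → ℝ), g x.2 * ellipticPDF P B (aug x.1 x.2)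
        ∂((volume.restrict (Ioi (0 : ℝ))).prod volume) := by
  set μ : Measure (ℝ × (ι → ℝ)) := (volume.restrict (Ioi (0 : ℝ))).prod volume with hμ
  set D := B - A with hD
  have hPD : ∀ t ∈ Icc (0 : ℝ) 1, (A + t • D).PosDef := fun t ht => posDef_add_smul_sub hA hB ht
  have hΔ : Δ.IsSymm := by
    have h : D.IsSymm := (isSymm_of_posDef hB).sub (isSymm_of_posDef hA)
    ext i j
    simpa [hAB, bordered] using h.apply (Sum.inr i) (Sum.inr j)
  have hgc : Continuous g := hg.continuous
  let W : ℝ → Matrix (Unit ⊕ ι) (Unit ⊕ ι) ℝ := fun t => (A + t • D)⁻¹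
  let e : ℝ → ℝ × (ι → ℝ) → ℝ := fun t x => g x.2 * ellipticPDF P (A + t • D) (aug x.1 x.2)
  let e' : ℝ → ℝ × (ι → ℝ) → ℝ := fun t x => g x.2 * ((√(A + t • D).det)⁻¹ *
    (1 / 2 * ∑ i, ∑ j, D i j * P.hess (W t) (aug x.1 x.2) i j))
  -- One compact set serves all `t`, since each diagonal entry of `A + t • D` is at most the sum of
  -- those of `A` and `B`.
  obtain ⟨K, hK, hKR⟩ : ∃ K : Set (ℝ × (ι → ℝ)), IsCompact K ∧ ∀ t ∈ Icc (0 : ℝ) 1,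
      ∀ x ∉ K, P.R < aug x.1 x.2 ⬝ᵥ (W t *ᵥ aug x.1 x.2) := by
    refine ⟨Metric.closedBall 0 √((∑ a, (A a a + B a a)) * P.R), isCompact_closedBall _ _,
      fun t ht x hx => ?_⟩
    by_contra hle
    refine hx (mem_closedBall_zero_iff.2 ((norm_prod_le_norm_aug x.1 x.2).trans ?_))
    refine norm_le_of_quadForm_inv_le (hPD t ht) (fun a => ?_) (not_lt.1 hle)
    have h1 := hA.diag_pos (i := a)
    have h2 := hB.diag_pos (i := a)
    refine le_trans ?_ (Finset.single_le_sum (f := fun a => A a a + B a a)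
      (fun b _ => (add_pos hA.diag_pos hB.diag_pos).le) (Finset.mem_univ a))
    simp only [hD, Matrix.add_apply, Matrix.smul_apply, Matrix.sub_apply, smul_eq_mul]
    nlinarith [ht.1, ht.2, mul_nonneg ht.1 h1.le, mul_le_mul_of_nonneg_right ht.2 h2.le]
  have he0 : ∀ t ∈ Icc (0 : ℝ) 1, ∀ x ∉ K, e t x = 0 := fun t ht x hx => by
    have := P.h_eq_zero _ (hKR t ht x hx)
    simp only [W] at this
    simp [e, ellipticPDF, this]
  have he'0 : ∀ t ∈ Icc (0 : ℝ) 1, ∀ x ∉ K, e' t x = 0 := fun t ht x hx => by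
    simp [e', RadialProfile.hess, P.h_eq_zero _ (hKR t ht x hx), P.h'_eq_zero _ (hKR t ht x hx)]
  have hsd := continuousOn_inv_sqrt_det_path hPD
  have hsd' : ContinuousOn (fun y : ℝ × (ℝ × (ι → ℝ)) => (√(A + y.1 • D).det)⁻¹)
      (Icc 0 1 ×ˢ univ) := hsd.comp continuousOn_fst fun _ hy => hy.1
  have hWc := continuousOn_inv_path hPD
  have hgc' : Continuous fun y : ℝ × (ℝ × (ι → ℝ)) => g y.2.2 := by fun_prop
  have hec : ContinuousOn (fun y : ℝ × (ℝ × (ι → ℝ)) => e y.1 y.2) (Icc 0 1 ×ˢ univ) := by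
    have h1 := P.continuous_h
    exact hgc'.continuousOn.mul (hsd'.mul (ContinuousOn.aug_matrix hWc
      (Ψ := fun q => P.h (q.2 ⬝ᵥ (q.1 *ᵥ q.2))) (by fun_prop)))
  have he'c : ContinuousOn (fun y : ℝ × (ℝ × (ι → ℝ)) => e' y.1 y.2) (Icc 0 1 ×ˢ univ) := by
    have h1 := P.continuous_h
    have h2 := P.continuous_h'
    exact hgc'.continuousOn.mul (hsd'.mul (ContinuousOn.aug_matrix hWc
      (Ψ := fun q => 1 / 2 * ∑ i, ∑ j, D i j * P.hess q.1 q.2 i j)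
      (by unfold RadialProfile.hess; fun_prop)))
  -- Joint continuity on `[0, 1] × K` and vanishing off `K` give a dominating multiple of the
  -- indicator of `K`, for the integrand and for its `t`-derivative alike.
  have hbound : ∀ φ : ℝ → ℝ × (ι → ℝ) → ℝ, (∀ t ∈ Icc (0 : ℝ) 1, ∀ x ∉ K, φ t x = 0) →
      ContinuousOn (fun y : ℝ × (ℝ × (ι → ℝ)) => φ y.1 y.2) (Icc 0 1 ×ˢ univ) →
      ∃ b : ℝ × (ι → ℝ) → ℝ, Integrable b μ ∧ ∀ t ∈ Icc (0 : ℝ) 1, ∀ x, ‖φ t x‖ ≤ b x := by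
    intro φ hφ0 hφ
    obtain ⟨C, hC⟩ := (isCompact_Icc.prod hK).exists_bound_of_continuousOn
      (hφ.mono (prod_mono subset_rfl (subset_univ K)))
    refine ⟨K.indicator fun _ => C,
      (integrable_indicator_iff hK.measurableSet).2 (integrableOn_const hK.measure_lt_top.ne),
      fun t ht x => ?_⟩
    by_cases hx : x ∈ K
    · rw [indicator_of_mem hx]
      exact hC (t, x) ⟨ht, hx⟩
    · rw [indicator_of_notMem hx, hφ0 t ht x hx, norm_zero]
  have hcx : ∀ φ : ℝ → ℝ × (ι → ℝ) → ℝ,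
      ContinuousOn (fun y : ℝ × (ℝ × (ι → ℝ)) => φ y.1 y.2) (Icc 0 1 ×ˢ univ) →
      ∀ t ∈ Icc (0 : ℝ) 1, Continuous (φ t) := fun φ hφ t ht =>
    hφ.comp_continuous (Continuous.prodMk_right t) fun x => ⟨ht, mem_univ x⟩
  obtain ⟨b, hbi, hb⟩ := hbound e he0 hec
  obtain ⟨b', hbi', hb'⟩ := hbound e' he'0 he'c
  have hcont : ContinuousOn (fun t => ∫ x, e t x ∂μ) (Icc 0 1) :=
    continuousOn_of_dominated (fun t ht => (hcx e hec t ht).aestronglyMeasurable)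
      (fun t ht => Eventually.of_forall (hb t ht)) hbi
      (Eventually.of_forall fun x => hec.comp (Continuous.prodMk_left x).continuousOn
        fun t ht => ⟨ht, mem_univ x⟩)
  have hder : ∀ t ∈ Ioo (0 : ℝ) 1, HasDerivAt (fun t => ∫ x, e t x ∂μ) (∫ x, e' t x ∂μ) t := by
    intro t ht
    have htI := Ioo_subset_Icc_self ht
    have hnhds : Ioo (0 : ℝ) 1 ∈ 𝓝 t := isOpen_Ioo.mem_nhds ht
    refine (hasDerivAt_integral_of_dominated_loc_of_deriv_le hnhds ?_ ?_
      (hcx e' he'c t htI).aestronglyMeasurable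
      (Eventually.of_forall fun x s hs => hb' s (Ioo_subset_Icc_self hs) x) hbi'
      (Eventually.of_forall fun x s hs => ?_)).2
    · filter_upwards [hnhds] with s hs
      exact (hcx e hec s (Ioo_subset_Icc_self hs)).aestronglyMeasurable
    · exact hbi.mono' (hcx e hec t htI).aestronglyMeasurable (Eventually.of_forall (hb t htI))
    · have h := (hasDerivAt_elliptic A D (aug x.1 x.2) s (hPD s (Ioo_subset_Icc_self hs))
        P.hasDerivAt_h).const_mul (g x.2)
      rw [← P.half_sum_hess] at h
      exact h
  have hmono : MonotoneOn (fun t => ∫ x, e t x ∂μ) (Icc 0 1) := by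
    refine monotoneOn_of_deriv_nonneg (convex_Icc 0 1) hcont ?_ ?_
    · rw [interior_Icc]
      exact fun t ht => (hder t ht).differentiableAt.differentiableWithinAt
    · rw [interior_Icc]
      intro t ht
      rw [(hder t ht).deriv]
      have hfac : ∀ x, e' t x = ((√(A + t • D).det)⁻¹ * (1 / 2)) * (g x.2 *
          ∑ i, ∑ j, bordered d Δ i j * P.hess (W t) (aug x.1 x.2) i j) := fun x => by
        simp only [e', ← hAB]
        ring
      simp only [hfac]
      rw [integral_const_mul]
      exact mul_nonneg (by positivity) (integral_halfSpace_hess_nonneg P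
        (hPD t (Ioo_subset_Icc_self ht)) hΔ hg hg1 hgg1 hpos hd)
  have := hmono (left_mem_Icc.2 zero_le_one) (right_mem_Icc.2 zero_le_one) zero_le_one
  simpa [e, hD] using this

theorem integrable_mul_ellipticPDF {ι : Type*} [Fintype ι] [DecidableEq ι] (P : RadialProfile)
    {A : Matrix (Unit ⊕ ι) (Unit ⊕ ι) ℝ} (hA : A.PosDef) {g : (ι → ℝ) → ℝ} (hg : Continuous g) :
    Integrable (fun x : ℝ × (ι → ℝ) => g x.2 * ellipticPDF P A (aug x.1 x.2))
      ((volume.restrict (Ioi (0 : ℝ))).prod volume) := by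
  obtain ⟨K, hK, hKR⟩ := exists_isCompact_aug P.R hA
  have h1 := P.continuous_h
  have h2 : Continuous fun x : ℝ × (ι → ℝ) => aug x.1 x.2 := continuous_aug
  refine integrable_halfSpace (by unfold ellipticPDF; fun_prop) (HasCompactSupport.intro hK
    fun x hx => by simp [ellipticPDF, P.h_eq_zero _ (hKR x hx)])

theorem ellipticPDF_nonneg {κ : Type*} [Fintype κ] [DecidableEq κ] (P : RadialProfile)
    (A : Matrix κ κ ℝ) (x : κ → ℝ) : 0 ≤ ellipticPDF P A x :=
  mul_nonneg (by positivity) (P.h_nonneg _)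

/-! ### Compactly supported approximations of the exponential -/

/-- An exponent of at least two makes the function `o(t)` at the kink, which is the only point in
question. -/
theorem hasDerivAt_max_zero_pow (m : ℕ) (t : ℝ) :
    HasDerivAt (fun t : ℝ => max 0 t ^ (m + 2)) ((m + 2) * max 0 t ^ (m + 1)) t := by
  rcases lt_trichotomy t 0 with ht | rfl | ht
  · have h : (fun t : ℝ => max 0 t ^ (m + 2)) =ᶠ[𝓝 t] fun _ => 0 := by
      filter_upwards [gt_mem_nhds ht] with s hs
      simp [max_eq_left hs.le]
    rw [max_eq_left ht.le, zero_pow (by omega), mul_zero]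
    exact (hasDerivAt_const t (0 : ℝ)).congr_of_eventuallyEq h
  · rw [hasDerivAt_iff_isLittleO]
    simp only [max_self, sub_zero, ne_eq, Nat.add_eq_zero_iff, OfNat.ofNat_ne_zero, and_false,
      not_false_eq_true, zero_pow, one_ne_zero, mul_zero, smul_zero]
    have h1 : (fun t : ℝ => max 0 t ^ (m + 2)) =O[𝓝 0] fun t : ℝ => t ^ (m + 2) := by
      refine Asymptotics.IsBigO.of_bound 1 (Eventually.of_forall fun s => ?_)
      rw [one_mul, norm_pow, norm_pow]
      gcongr
      rcases le_total s 0 with h | h <;> simp [h]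
    refine h1.trans_isLittleO ?_
    simpa using Asymptotics.isLittleO_pow_pow (𝕜 := ℝ) (show 1 < m + 2 by omega)
  · have h : (fun t : ℝ => max 0 t ^ (m + 2)) =ᶠ[𝓝 t] fun t => t ^ (m + 2) := by
      filter_upwards [lt_mem_nhds ht] with s hs
      simp [max_eq_right hs.le]
    rw [max_eq_right ht.le]
    have := hasDerivAt_pow (m + 2) t
    push_cast at this
    exact this.congr_of_eventuallyEq h

/-- The generator `(1 - s / (2N))₊ᴺ` with `N = m + 2`, which tends to `exp (-s / 2)`. -/
noncomputable def truncatedExp (m : ℕ) : RadialProfile where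
  h s := max 0 (1 - s / (2 * (m + 2))) ^ (m + 2)
  h' s := -(1 / 2) * max 0 (1 - s / (2 * (m + 2))) ^ (m + 1)
  -- The factor compensates the exponent `m + 3` and the inner derivative `-1 / (2 (m + 2))`, so
  -- that `G' = -h / 2`.
  G s := (m + 2) / (m + 3) * max 0 (1 - s / (2 * (m + 2))) ^ (m + 3)
  R := 2 * (m + 2)
  hasDerivAt_h s := by
    have h1 : HasDerivAt (fun s : ℝ => 1 - s / (2 * ((m : ℝ) + 2))) (-(1 / (2 * (m + 2)))) s :=
      ((hasDerivAt_id s).div_const _).const_sub 1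
    have h2 := HasDerivAt.comp s (hasDerivAt_max_zero_pow m _) h1
    convert! h2 using 1
    field_simp
  hasDerivAt_G s := by
    have h1 : HasDerivAt (fun s : ℝ => 1 - s / (2 * ((m : ℝ) + 2))) (-(1 / (2 * (m + 2)))) s :=
      ((hasDerivAt_id s).div_const _).const_sub 1
    have h2 := (HasDerivAt.comp s (hasDerivAt_max_zero_pow (m + 1) _) h1).const_mul
      (((m : ℝ) + 2) / (m + 3))
    convert! h2 using 1
    push_cast
    field_simp
    ring
  continuous_h' := by fun_prop
  h_nonneg s := by positivity
  G_nonneg s := by positivity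
  h_eq_zero s hs := by
    have : 1 - s / (2 * ((m : ℝ) + 2)) ≤ 0 := by
      rw [sub_nonpos, le_div_iff₀ (by positivity)]
      linarith
    simp [max_eq_left this]
  h'_eq_zero s hs := by
    have : 1 - s / (2 * ((m : ℝ) + 2)) ≤ 0 := by
      rw [sub_nonpos, le_div_iff₀ (by positivity)]
      linarith
    simp [max_eq_left this]
  G_eq_zero s hs := by
    have : 1 - s / (2 * ((m : ℝ) + 2)) ≤ 0 := by
      rw [sub_nonpos, le_div_iff₀ (by positivity)]
      linarith
    simp [max_eq_left this]

/-- With `N = m + 2` this is `(1 - x / N)ᴺ ≤ exp (-x)` at `x = s / 2` for `x ≤ N`; beyond that the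
left side is zero. It supplies the dominating function for the limit. -/
theorem truncatedExp_le (m : ℕ) (s : ℝ) : (truncatedExp m).h s ≤ Real.exp (-(1 / 2) * s) := by
  have hdiv : 1 - s / (2 * ((m : ℝ) + 2)) = 1 - (s / 2) / ((m + 2 : ℕ) : ℝ) := by
    push_cast
    field_simp
  simp only [truncatedExp, hdiv]
  have hexp : Real.exp (-(1 / 2) * s) = Real.exp (-(s / 2)) := by
    congr 1
    ring
  rw [hexp]
  rcases le_total (s / 2) ((m + 2 : ℕ) : ℝ) with h | h
  · rw [max_eq_right (sub_nonneg.2 (div_le_one_of_le₀ h (by positivity)))]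
    exact Real.one_sub_div_pow_le_exp_neg h
  · rw [max_eq_left (sub_nonpos.2 ((one_le_div₀ (by positivity)).2 h)), zero_pow (by omega)]
    positivity

theorem tendsto_truncatedExp (s : ℝ) :
    Tendsto (fun m => (truncatedExp m).h s) atTop (𝓝 (Real.exp (-(1 / 2) * s))) := by
  have h1 := (Real.tendsto_one_add_div_pow_exp (-(1 / 2) * s)).comp (tendsto_add_atTop_nat 2)
  refine h1.congr' ?_
  obtain ⟨k, hk⟩ := exists_nat_ge s
  filter_upwards [eventually_ge_atTop k] with m hm
  have hm' : (k : ℝ) ≤ m := by exact_mod_cast hm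
  -- Once `m ≥ s` the truncation is inactive and the classical limit of `(1 + x / N)ᴺ` applies.
  have hnn : 0 ≤ 1 - s / (2 * ((m : ℝ) + 2)) := by
    rw [sub_nonneg, div_le_one₀ (by positivity)]
    have : (0 : ℝ) ≤ m := Nat.cast_nonneg m
    linarith
  simp only [Function.comp, truncatedExp, max_eq_right hnn]
  congr 1
  push_cast
  field_simp
  ring

/-! ### Gaussian integrals over a half line -/

theorem stdNormalCDF_eq_integral (w : ℝ) :
    stdNormalCDF w = (√(2 * π))⁻¹ * ∫ t in Iic w, Real.exp (-(1 / 2) * t ^ 2) := by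
  rw [stdNormalCDF, cdf_eq_real, measureReal_def, gaussianReal_apply_eq_integral _ one_ne_zero,
    ENNReal.toReal_ofReal (setIntegral_nonneg measurableSet_Iic fun t _ =>
      gaussianPDFReal_nonneg 0 1 t), ← integral_const_mul]
  refine setIntegral_congr_fun measurableSet_Iic fun t _ => ?_
  simp only [gaussianPDFReal, NNReal.coe_one, mul_one, sub_zero]
  congr 2
  ring

theorem stdNormalCDF_nonneg (w : ℝ) : 0 ≤ stdNormalCDF w := cdf_nonneg _ _

theorem measurable_stdNormalCDF : Measurable stdNormalCDF := (monotone_cdf _).measurable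

/-- The mass that a normal distribution with mean `s w` and standard deviation `s` puts on the
positive half line. -/
theorem integral_Ioi_exp_neg_sq {s : ℝ} (hs : 0 < s) (w : ℝ) :
    ∫ u in Ioi (0 : ℝ), Real.exp (-(1 / 2) * ((u - s * w) ^ 2 / s ^ 2)) =
      s * √(2 * π) * stdNormalCDF w := by
  have h1 := integral_comp_mul_left_Ioi
    (fun u => Real.exp (-(1 / 2) * ((u - s * w) ^ 2 / s ^ 2))) 0 hs
  rw [mul_zero] at h1
  have h2 : ∀ x, Real.exp (-(1 / 2) * ((s * x - s * w) ^ 2 / s ^ 2)) =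
      Real.exp (-(1 / 2) * (x - w) ^ 2) := fun x => by
    congr 2
    field_simp
  simp only [h2, smul_eq_mul] at h1
  -- The reflection `t = w - x` maps the positive half line to the half line below `w`.
  have h3 : ∫ x in Ioi (0 : ℝ), Real.exp (-(1 / 2) * (x - w) ^ 2) =
      ∫ t in Iic w, Real.exp (-(1 / 2) * t ^ 2) := by
    rw [← integral_indicator measurableSet_Ioi, integral_Iic_eq_integral_Iio,
      ← integral_indicator measurableSet_Iio,
      ← integral_sub_left_eq_self _ (volume : Measure ℝ) w]
    refine integral_congr_ae (Eventually.of_forall fun t => ?_)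
    simp only [indicator, mem_Ioi, mem_Iio, sub_pos]
    split_ifs
    · congr 2
      ring
    · rfl
  have h4 : √(2 * π) ≠ 0 := by positivity
  rw [h3] at h1
  rw [stdNormalCDF_eq_integral, h1]
  field_simp

theorem integrable_exp_neg_sq_shift {s : ℝ} (hs : 0 < s) (w : ℝ) :
    Integrable fun u : ℝ => Real.exp (-(1 / 2) * ((u - s * w) ^ 2 / s ^ 2)) := by
  have h := (integrable_exp_neg_mul_sq (b := 1 / 2 / s ^ 2) (by positivity)).comp_sub_right (s * w)
  refine h.congr (Eventually.of_forall fun u => ?_)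
  simp only
  congr 1
  ring

/-! ### The conditioning representation of the skew-normal law -/

/-- The covariance matrix of `(U, Z)` in the representation of the skew-normal law as the law of
`Z` given `U > 0`. -/
def jointCov {ι : Type*} (δ : ι → ℝ) (Ω : Matrix ι ι ℝ) : Matrix (Unit ⊕ ι) (Unit ⊕ ι) ℝ :=
  fromBlocks 1 (replicateRow Unit δ) (replicateCol Unit δ) Ω

theorem jointCov_sub {ι : Type*} (δ δ' : ι → ℝ) (Ω Ω' : Matrix ι ι ℝ) :
    jointCov δ' Ω' - jointCov δ Ω = bordered (δ' - δ) (Ω' - Ω) := by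
  ext (i | i) (j | j) <;> simp [jointCov, bordered]

theorem jointCov_mulVec_aug {ι : Type*} [Fintype ι] (δ : ι → ℝ) (Ω : Matrix ι ι ℝ) (u : ℝ)
    (z : ι → ℝ) : jointCov δ Ω *ᵥ aug u z = aug (u + δ ⬝ᵥ z) (u • δ + Ω *ᵥ z) := by
  ext (i | i)
  · simp [jointCov, aug, mulVec, dotProduct]
  · simp [jointCov, aug, mulVec, dotProduct, mul_comm]

theorem aug_dotProduct_aug {ι : Type*} [Fintype ι] (u v : ℝ) (y z : ι → ℝ) :
    aug u y ⬝ᵥ aug v z = u * v + y ⬝ᵥ z := by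
  simp [aug, dotProduct]

theorem exists_eq_aug {ι : Type*} (x : Unit ⊕ ι → ℝ) : ∃ u z, x = aug u z :=
  ⟨x (Sum.inl ()), fun i => x (Sum.inr i), by ext (i | i) <;> rfl⟩

/-- Completing the square with `y = Ω⁻¹ δ` writes the form as `(1 - δᵀ Ω⁻¹ δ) u²` plus the form `Ω`
at `z + u y`. -/
theorem posDef_jointCov {ι : Type*} [Fintype ι] [DecidableEq ι] {δ : ι → ℝ} {Ω : Matrix ι ι ℝ}
    (hΩ : Ω.PosDef) (hδ : 0 < 1 - δ ⬝ᵥ (Ω⁻¹ *ᵥ δ)) : (jointCov δ Ω).PosDef := by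
  refine Matrix.PosDef.of_dotProduct_mulVec_pos ?_ fun x hx => ?_
  · rw [Matrix.IsHermitian, conjTranspose_eq_transpose_of_trivial, jointCov, fromBlocks_transpose,
      (isSymm_of_posDef hΩ).eq]
    simp
  · obtain ⟨u, z, rfl⟩ := exists_eq_aug x
    rw [star_trivial, jointCov_mulVec_aug, aug_dotProduct_aug]
    set y := Ω⁻¹ *ᵥ δ with hy
    have hΩy : Ω *ᵥ y = δ := by
      rw [hy, mulVec_mulVec, mul_nonsing_inv _ (isUnit_det_of_posDef hΩ), one_mulVec]
    have hzy : y ⬝ᵥ (Ω *ᵥ z) = δ ⬝ᵥ z := by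
      rw [dotProduct_mulVec_comm_of_isSymm (isSymm_of_posDef hΩ), hΩy, dotProduct_comm]
    have hkey : u * (u + δ ⬝ᵥ z) + z ⬝ᵥ (u • δ + Ω *ᵥ z) =
        (1 - δ ⬝ᵥ y) * u ^ 2 + (z + u • y) ⬝ᵥ (Ω *ᵥ (z + u • y)) := by
      simp only [mulVec_add, mulVec_smul, hΩy, add_dotProduct, dotProduct_add, smul_dotProduct,
        dotProduct_smul, smul_eq_mul, hzy, dotProduct_comm z δ, dotProduct_comm y δ]
      ring
    rw [hkey]
    have hnn : 0 ≤ (z + u • y) ⬝ᵥ (Ω *ᵥ (z + u • y)) := by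
      simpa using hΩ.posSemidef.dotProduct_mulVec_nonneg (z + u • y)
    by_cases hu : u = 0
    · subst hu
      have hz : z ≠ 0 := by
        rintro rfl
        exact hx (by ext (i | i) <;> rfl)
      simpa using hΩ.dotProduct_mulVec_pos hz
    · have : 0 < (1 - δ ⬝ᵥ y) * u ^ 2 := by positivity
      linarith

theorem det_jointCov {ι : Type*} [Fintype ι] [DecidableEq ι] {δ : ι → ℝ} {Ω : Matrix ι ι ℝ}
    (hΩ : Ω.PosDef) : (jointCov δ Ω).det = Ω.det * (1 - δ ⬝ᵥ (Ω⁻¹ *ᵥ δ)) := by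
  let := Ω.invertibleOfIsUnitDet (isUnit_det_of_posDef hΩ)
  rw [jointCov, det_fromBlocks₂₂, det_unique (n := Unit), invOf_eq_nonsing_inv, Matrix.mul_assoc]
  simp [Matrix.mul_apply, dotProduct, mulVec]

/-- This splits the joint density into the marginal of `Z` and the conditional law of `U` given `Z =
z`, with mean `δᵀ Ω⁻¹ z` and variance `1 - δᵀ Ω⁻¹ δ`. The inverse is found by solving the block
system explicitly. -/
theorem quadForm_inv_jointCov {ι : Type*} [Fintype ι] [DecidableEq ι] {δ : ι → ℝ}
    {Ω : Matrix ι ι ℝ} (hΩ : Ω.PosDef) (hδ : 0 < 1 - δ ⬝ᵥ (Ω⁻¹ *ᵥ δ)) (u : ℝ) (z : ι → ℝ) :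
    aug u z ⬝ᵥ ((jointCov δ Ω)⁻¹ *ᵥ aug u z) =
      z ⬝ᵥ (Ω⁻¹ *ᵥ z) + (u - δ ⬝ᵥ (Ω⁻¹ *ᵥ z)) ^ 2 / (1 - δ ⬝ᵥ (Ω⁻¹ *ᵥ δ)) := by
  have hu := isUnit_det_of_posDef hΩ
  set c := 1 - δ ⬝ᵥ (Ω⁻¹ *ᵥ δ) with hc
  set s := (u - δ ⬝ᵥ (Ω⁻¹ *ᵥ z)) / c with hs
  have hsol : jointCov δ Ω *ᵥ aug s (Ω⁻¹ *ᵥ z - s • (Ω⁻¹ *ᵥ δ)) = aug u z := by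
    rw [jointCov_mulVec_aug]
    congr 1
    · have : s * c = u - δ ⬝ᵥ (Ω⁻¹ *ᵥ z) := div_mul_cancel₀ _ hδ.ne'
      rw [hc] at this
      simp only [dotProduct_sub, dotProduct_smul, smul_eq_mul]
      linarith
    · simp only [mulVec_sub, mulVec_smul, mulVec_mulVec, mul_nonsing_inv _ hu, one_mulVec]
      abel
  have hinv : (jointCov δ Ω)⁻¹ *ᵥ aug u z = aug s (Ω⁻¹ *ᵥ z - s • (Ω⁻¹ *ᵥ δ)) := by
    rw [← hsol, mulVec_mulVec, nonsing_inv_mul _ (isUnit_det_of_posDef (posDef_jointCov hΩ hδ)),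
      one_mulVec]
  have hsymm : z ⬝ᵥ (Ω⁻¹ *ᵥ δ) = δ ⬝ᵥ (Ω⁻¹ *ᵥ z) :=
    dotProduct_mulVec_comm_of_isSymm (isSymm_of_posDef hΩ.inv) _ _
  rw [hinv, aug_dotProduct_aug, dotProduct_sub, dotProduct_smul, hsymm, smul_eq_mul, hs]
  ring

theorem isUnit_det_scaleDiag {ι : Type*} [Fintype ι] [DecidableEq ι] {Ω : Matrix ι ι ℝ}
    (hΩ : Ω.PosDef) : IsUnit (scaleDiag Ω).det := by
  rw [scaleDiag, det_diagonal]
  exact (Finset.prod_pos fun i _ => Real.sqrt_pos.2 hΩ.diag_pos).ne'.isUnit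

theorem dotProduct_inv_scaleDiag {ι : Type*} [Fintype ι] [DecidableEq ι] {Ω : Matrix ι ι ℝ}
    (x y : ι → ℝ) : x ⬝ᵥ ((scaleDiag Ω)⁻¹ *ᵥ y) = ((scaleDiag Ω)⁻¹ *ᵥ x) ⬝ᵥ y := by
  have : ((scaleDiag Ω)⁻¹).IsSymm := by
    rw [Matrix.IsSymm, transpose_nonsing_inv, scaleDiag, diagonal_transpose]
  rw [dotProduct_mulVec_comm_of_isSymm this, dotProduct_comm]

/-- Since `ω Ω̄ = Ω ω⁻¹`, everything is expressed through the single vector `ω⁻¹ α`. -/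
theorem deltaOfAlpha_eq {ι : Type*} [Fintype ι] [DecidableEq ι] {Ω : Matrix ι ι ℝ}
    (hΩ : Ω.PosDef) (α : ι → ℝ) :
    deltaOfAlpha Ω α = (√(1 + ((scaleDiag Ω)⁻¹ *ᵥ α) ⬝ᵥ (Ω *ᵥ ((scaleDiag Ω)⁻¹ *ᵥ α))))⁻¹ •
      (Ω *ᵥ ((scaleDiag Ω)⁻¹ *ᵥ α)) := by
  have h := mul_nonsing_inv _ (isUnit_det_scaleDiag hΩ)
  rw [deltaOfAlpha, corrMatrix, ← dotProduct_inv_scaleDiag]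
  simp only [mulVec_mulVec, Matrix.mul_assoc]
  rw [← Matrix.mul_assoc (scaleDiag Ω), h, Matrix.one_mul]

/-- The joint quadratic form that belongs to a skew-normal distribution. -/
theorem jointCov_deltaOfAlpha {ι : Type*} [Fintype ι] [DecidableEq ι] {Ω : Matrix ι ι ℝ}
    (hΩ : Ω.PosDef) (α : ι → ℝ) :
    ∃ s : ℝ, 0 < s ∧ (jointCov (deltaOfAlpha Ω α) Ω).PosDef ∧
      (jointCov (deltaOfAlpha Ω α) Ω).det = Ω.det * s ^ 2 ∧
      ∀ (u : ℝ) (z : ι → ℝ),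
        aug u z ⬝ᵥ ((jointCov (deltaOfAlpha Ω α) Ω)⁻¹ *ᵥ aug u z) =
          z ⬝ᵥ (Ω⁻¹ *ᵥ z) + (u - s * (α ⬝ᵥ ((scaleDiag Ω)⁻¹ *ᵥ z))) ^ 2 / s ^ 2 := by
  have hu := isUnit_det_of_posDef hΩ
  set b := (scaleDiag Ω)⁻¹ *ᵥ α with hb
  set q := b ⬝ᵥ (Ω *ᵥ b) with hq
  have hq0 : 0 ≤ q := by simpa using hΩ.posSemidef.dotProduct_mulVec_nonneg b
  -- This is the conditional standard deviation of `U` given `Z`. The conditional mean is `s αᵀ ω⁻¹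
  -- z`, so the standardized mean is the argument of `Φ` in the skew-normal density.
  set s := (√(1 + q))⁻¹ with hs
  have hs0 : 0 < s := by positivity
  have hδ : deltaOfAlpha Ω α = s • (Ω *ᵥ b) := deltaOfAlpha_eq hΩ α
  have hsq : s ^ 2 = (1 + q)⁻¹ := by rw [hs, inv_pow, Real.sq_sqrt (by positivity)]
  have hlin : ∀ z, deltaOfAlpha Ω α ⬝ᵥ (Ω⁻¹ *ᵥ z) = s * (b ⬝ᵥ z) := fun z => by
    rw [hδ, smul_dotProduct, dotProduct_comm,
      ← dotProduct_mulVec_comm_of_isSymm (isSymm_of_posDef hΩ), mulVec_mulVec,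
      mul_nonsing_inv _ hu, one_mulVec, smul_eq_mul]
  have hquad : 1 - deltaOfAlpha Ω α ⬝ᵥ (Ω⁻¹ *ᵥ deltaOfAlpha Ω α) = s ^ 2 := by
    rw [hlin, hδ, dotProduct_smul, ← hq, smul_eq_mul, ← mul_assoc, ← sq, hsq]
    have : 1 + q ≠ 0 := by positivity
    field_simp
    ring
  have hpos : 0 < 1 - deltaOfAlpha Ω α ⬝ᵥ (Ω⁻¹ *ᵥ deltaOfAlpha Ω α) := by
    rw [hquad]
    positivity
  refine ⟨s, hs0, posDef_jointCov hΩ hpos, by rw [det_jointCov hΩ, hquad], fun u z => ?_⟩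
  rw [quadForm_inv_jointCov hΩ hpos, hquad, hlin, dotProduct_inv_scaleDiag]

/-! ### Passage to the limit -/

/-- The truncated densities of `(U, Z)` on the half space `u > 0` converge to a multiple of the
skew-normal density. -/
theorem tendsto_integral_truncatedExp {ι : Type*} [Fintype ι] [DecidableEq ι] {Ω : Matrix ι ι ℝ}
    (hΩ : Ω.PosDef) (α : ι → ℝ) {g : (ι → ℝ) → ℝ} (hg : Continuous g)
    (hgi : Integrable fun z => g z * skewNormalPDF 0 Ω α z) :
    Tendsto (fun m => ∫ x : ℝ × (ι → ℝ),
        g x.2 * ellipticPDF (truncatedExp m) (jointCov (deltaOfAlpha Ω α) Ω) (aug x.1 x.2)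
          ∂((volume.restrict (Ioi (0 : ℝ))).prod volume)) atTop
      (𝓝 (√(2 * π) * √((2 * π) ^ Fintype.card ι) / 2 * ∫ z, g z * skewNormalPDF 0 Ω α z)) := by
  obtain ⟨s, hs, hA, hdet, hQ⟩ := jointCov_deltaOfAlpha hΩ α
  set A := jointCov (deltaOfAlpha Ω α) Ω with hAdef
  -- The factor `s` from the `u`-integral cancels against the one in `√A.det`, so `C` depends only
  -- on the dimension.
  set C := √(2 * π) * √((2 * π) ^ Fintype.card ι) / 2 with hC
  let E : ℝ × (ι → ℝ) → ℝ := fun x =>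
    (√A.det)⁻¹ * Real.exp (-(1 / 2) * (aug x.1 x.2 ⬝ᵥ (A⁻¹ *ᵥ aug x.1 x.2)))
  have haug : Continuous fun x : ℝ × (ι → ℝ) => aug x.1 x.2 := continuous_aug
  have hEc : Continuous E := by fun_prop
  have hE0 : ∀ x, 0 ≤ E x := fun x => by positivity
  have hEfac : ∀ u z, E (u, z) = (√A.det)⁻¹ * Real.exp (-(1 / 2) * (z ⬝ᵥ (Ω⁻¹ *ᵥ z))) *
      Real.exp (-(1 / 2) * ((u - s * (α ⬝ᵥ ((scaleDiag Ω)⁻¹ *ᵥ z))) ^ 2 / s ^ 2)) := fun u z => by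
    simp only [E, hQ, mul_add, Real.exp_add]
    ring
  have hinner : ∀ z, ∫ u in Ioi (0 : ℝ), E (u, z) = C * skewNormalPDF 0 Ω α z := by
    intro z
    simp only [hEfac]
    rw [integral_const_mul, integral_Ioi_exp_neg_sq hs, hdet, Real.sqrt_mul hΩ.det_pos.le,
      Real.sqrt_sq hs.le, skewNormalPDF, normalPDF,
      Real.sqrt_mul (by positivity : 0 ≤ (2 * π) ^ Fintype.card ι) Ω.det,
      sub_zero, hC]
    have h1 : √Ω.det ≠ 0 := Real.sqrt_ne_zero'.2 hΩ.det_pos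
    have h2 : √((2 * π) ^ Fintype.card ι) ≠ 0 := by positivity
    generalize √(2 * π) = r
    field_simp
  have hEi : ∀ z, Integrable (fun u => E (u, z)) (volume.restrict (Ioi (0 : ℝ))) := fun z => by
    simp only [hEfac]
    exact ((integrable_exp_neg_sq_shift hs _).const_mul _).restrict
  have hFi : Integrable (fun x : ℝ × (ι → ℝ) => g x.2 * E x)
      ((volume.restrict (Ioi (0 : ℝ))).prod volume) := by
    -- By Tonelli, integrability on the half space reduces to that of `g` against the skew-normal
    -- density.
    refine (integrable_prod_iff' (by fun_prop : Continuous _).aestronglyMeasurable).2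
      ⟨Eventually.of_forall fun z => (hEi z).const_mul (g z), ?_⟩
    have : ∀ z, ∫ u in Ioi (0 : ℝ), ‖g z * E (u, z)‖ = C * ‖g z * skewNormalPDF 0 Ω α z‖ := by
      intro z
      have hpdf : 0 ≤ skewNormalPDF 0 Ω α z := by
        have := stdNormalCDF_nonneg (α ⬝ᵥ ((scaleDiag Ω)⁻¹ *ᵥ (z - 0)))
        unfold skewNormalPDF normalPDF
        positivity
      simp only [norm_mul, Real.norm_of_nonneg (hE0 _), Real.norm_of_nonneg hpdf]
      rw [integral_const_mul, hinner]
      ring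
    simp only [this]
    exact hgi.norm.const_mul C
  have hlim : ∫ x : ℝ × (ι → ℝ), g x.2 * E x ∂((volume.restrict (Ioi (0 : ℝ))).prod volume) =
      C * ∫ z, g z * skewNormalPDF 0 Ω α z := by
    rw [integral_prod_symm _ hFi, ← integral_const_mul]
    refine integral_congr_ae (Eventually.of_forall fun z => ?_)
    simp only
    rw [integral_const_mul, hinner]
    ring
  rw [← hlim]
  refine tendsto_integral_of_dominated_convergence (fun x => ‖g x.2 * E x‖)
    (fun m => (integrable_mul_ellipticPDF _ hA hg).aestronglyMeasurable) hFi.norm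
    (fun m => Eventually.of_forall fun x => ?_) (Eventually.of_forall fun x => ?_)
  · rw [norm_mul, norm_mul, Real.norm_of_nonneg (hE0 x),
      Real.norm_of_nonneg (ellipticPDF_nonneg _ _ _)]
    exact mul_le_mul_of_nonneg_left (mul_le_mul_of_nonneg_left (truncatedExp_le _ _)
      (by positivity)) (norm_nonneg _)
  · exact ((tendsto_truncatedExp _).const_mul _).const_mul _

/-! ### Vectorization of matrices and its effect on integrals -/

section Vectorization

variable {n p : ℕ}

/-- Vectorization of matrices, as a homeomorphism. -/
def vecHomeomorph (n p : ℕ) : (Fin n → Fin p → ℝ) ≃ₜ (Fin p × Fin n → ℝ) where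
  toFun X a := X a.2 a.1
  invFun z k j := z (j, k)
  left_inv _ := rfl
  right_inv _ := rfl
  continuous_toFun := by fun_prop
  continuous_invFun := by fun_prop

/-- The inverse of vectorization, as a continuous linear map. -/
def unvec (n p : ℕ) : (Fin p × Fin n → ℝ) →L[ℝ] (Fin n → Fin p → ℝ) where
  toFun z k j := z (j, k)
  map_add' _ _ := rfl
  map_smul' _ _ := rfl
  cont := by fun_prop

theorem measurePreserving_vecHomeomorph (n p : ℕ) :
    MeasurePreserving (vecHomeomorph n p) volume volume := by
  refine ⟨(vecHomeomorph n p).continuous.measurable, ?_⟩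
  rw [volume_pi]
  symm
  refine Measure.pi_eq fun s hs => ?_
  rw [Measure.map_apply (vecHomeomorph n p).continuous.measurable
    (MeasurableSet.univ_pi fun i => hs i)]
  have : vecHomeomorph n p ⁻¹' (univ.pi s) = univ.pi fun k => univ.pi fun j => s (j, k) := by
    ext X
    simp only [mem_preimage, Set.mem_pi, mem_univ, true_imp_iff, Prod.forall]
    exact forall_comm
  rw [this, ← volume_pi, volume_pi_pi]
  simp only [volume_pi_pi]
  rw [Fintype.prod_prod_type, Finset.prod_comm]

theorem unvec_single (j : Fin p) (k : Fin n) :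
    unvec n p (Pi.single (j, k) 1) = (Matrix.single k j (1 : ℝ) : Fin n → Fin p → ℝ) := by
  ext k' j'
  simp only [unvec, ContinuousLinearMap.coe_mk', LinearMap.coe_mk, AddHom.coe_mk, Pi.single_apply,
    Matrix.single, Matrix.of_apply, Prod.mk.injEq]
  congr 1
  simp only [eq_iff_iff]
  tauto

theorem vecHomeomorph_symm_add (M : Fin n → Fin p → ℝ) (z : Fin p × Fin n → ℝ) :
    (vecHomeomorph n p).symm (z + vecHomeomorph n p M) = M + unvec n p z := by
  ext k j
  simp [vecHomeomorph, unvec, add_comm]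

theorem integral_comp_add_unvec (M : Fin n → Fin p → ℝ) (F : (Fin n → Fin p → ℝ) → ℝ) :
    ∫ z, F (M + unvec n p z) = ∫ X, F X := by
  have h := ((measurePreserving_vecHomeomorph n p).symm
    (vecHomeomorph n p).toMeasurableEquiv).integral_comp
    (vecHomeomorph n p).symm.measurableEmbedding F
  refine Eq.trans ?_ ((integral_add_right_eq_self _ (vecHomeomorph n p M)).trans h)
  exact integral_congr_ae (Eventually.of_forall fun z =>
    congrArg F (vecHomeomorph_symm_add M z).symm)

theorem integrable_comp_add_unvec (M : Fin n → Fin p → ℝ) {F : (Fin n → Fin p → ℝ) → ℝ}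
    (hF : Integrable F) : Integrable fun z => F (M + unvec n p z) := by
  have h1 : Integrable (F ∘ (vecHomeomorph n p).symm) :=
    ((measurePreserving_vecHomeomorph n p).symm (vecHomeomorph n p).toMeasurableEquiv
      |>.integrable_comp_emb (vecHomeomorph n p).symm.measurableEmbedding).2 hF
  refine (h1.comp_add_right (vecHomeomorph n p M)).congr (Eventually.of_forall fun z => ?_)
  exact congrArg F (vecHomeomorph_symm_add M z)

end Vectorization

/-! ### Expectations as integrals and their comparison -/

theorem skewNormalPDF_nonneg {ι : Type*} [Fintype ι] [DecidableEq ι] (μ : ι → ℝ)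
    (Ω : Matrix ι ι ℝ) (α z : ι → ℝ) : 0 ≤ skewNormalPDF μ Ω α z := by
  have := stdNormalCDF_nonneg (α ⬝ᵥ ((scaleDiag Ω)⁻¹ *ᵥ (z - μ)))
  unfold skewNormalPDF normalPDF
  positivity

theorem measurable_skewNormalPDF {ι : Type*} [Fintype ι] [DecidableEq ι] (μ : ι → ℝ)
    (Ω : Matrix ι ι ℝ) (α : ι → ℝ) : Measurable (skewNormalPDF μ Ω α) := by
  have h1 : Continuous (normalPDF μ Ω) := by
    unfold normalPDF
    fun_prop
  have h2 : Continuous fun z => α ⬝ᵥ ((scaleDiag Ω)⁻¹ *ᵥ (z - μ)) := by fun_prop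
  exact (h1.measurable.const_mul 2).mul (measurable_stdNormalCDF.comp h2.measurable)

theorem skewNormalPDF_add {ι : Type*} [Fintype ι] [DecidableEq ι] (μ : ι → ℝ)
    (Ω : Matrix ι ι ℝ) (α z : ι → ℝ) :
    skewNormalPDF μ Ω α (μ + z) = skewNormalPDF 0 Ω α z := by
  simp [skewNormalPDF, normalPDF]

instance borelSpace_matrix {n p : ℕ} : BorelSpace (Matrix (Fin n) (Fin p) ℝ) :=
  inferInstanceAs (BorelSpace (Fin n → Fin p → ℝ))

/-- The expectation of a function of a skew-normal random matrix as an integral over `ℝⁿᵖ`. -/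
theorem expectation_matrixSkewNormal {n p : ℕ} {Ω₁ : Type*} [MeasurableSpace Ω₁] {P : Measure Ω₁}
    {X : Ω₁ → Matrix (Fin n) (Fin p) ℝ} {M : Fin n → Fin p → ℝ}
    {B : Matrix (Fin n) (Fin p) ℝ} {Ω : Matrix (Fin p × Fin n) (Fin p × Fin n) ℝ}
    (hX : HasLaw X (matrixSkewNormal M Ω B) P)
    {f : (Fin n → Fin p → ℝ) → ℝ} (hf : Continuous f) (hfX : Integrable (fun w => f (X w)) P) :
    Integrable (fun z => f (M + unvec n p z) * skewNormalPDF 0 Ω B.vec z) ∧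
      ∫ w, f (X w) ∂P = ∫ z, f (M + unvec n p z) * skewNormalPDF 0 Ω B.vec z := by
  let f₀ : Matrix (Fin n) (Fin p) ℝ → ℝ := f
  have hf₀ : Continuous f₀ := hf
  let φ : Matrix (Fin n) (Fin p) ℝ → ℝ := fun Y => skewNormalPDF (vec M) Ω B.vec Y.vec
  have hφm : Measurable φ := by
    refine (measurable_skewNormalPDF _ _ _).comp ?_
    exact (vecHomeomorph n p).continuous.measurable
  have hφ0 : ∀ Y, 0 ≤ φ Y := fun Y => skewNormalPDF_nonneg _ _ _ _
  have hlaw : matrixSkewNormal M Ω B = volume.withDensity fun Y => ENNReal.ofReal (φ Y) := rfl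
  have hshift : ∀ z, φ (M + unvec n p z : Fin n → Fin p → ℝ) = skewNormalPDF 0 Ω B.vec z :=
    fun z => skewNormalPDF_add (vec M) Ω B.vec z
  have hint : Integrable f₀ (matrixSkewNormal M Ω B) := by
    rw [← hX.map_eq]
    exact (integrable_map_measure hf₀.aestronglyMeasurable hX.aemeasurable).2 hfX
  have hint' : Integrable (fun Y => f₀ Y * φ Y) (volume : Measure (Matrix (Fin n) (Fin p) ℝ)) := by
    rw [hlaw, integrable_withDensity_iff_integrable_smul' hφm.ennreal_ofReal (by simp)] at hint
    refine hint.congr (Eventually.of_forall fun Y => ?_)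
    simp only [ENNReal.toReal_ofReal (hφ0 Y), smul_eq_mul, mul_comm]
  have heq : ∫ w, f (X w) ∂P = ∫ Y, f₀ Y * φ Y := by
    have h := hX.integral_comp (f := f₀) hf₀.aestronglyMeasurable
    rw [hlaw, integral_withDensity_eq_integral_toReal_smul hφm.ennreal_ofReal (by simp)] at h
    refine h.trans (integral_congr_ae (Eventually.of_forall fun Y => ?_))
    simp only [ENNReal.toReal_ofReal (hφ0 Y), smul_eq_mul, mul_comm]
  have hI := integrable_comp_add_unvec M hint'
  have hE := integral_comp_add_unvec M fun Y => f₀ Y * φ Y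
  simp only [hshift] at hI hE
  exact ⟨hI, heq.trans hE.symm⟩

theorem le_add_of_fderiv_nonneg {E : Type*} [NormedAddCommGroup E] [NormedSpace ℝ E] {f : E → ℝ}
    (hf : Differentiable ℝ f) {v : E} (hv : ∀ x, 0 ≤ fderiv ℝ f x v) (x : E) :
    f x ≤ f (x + v) := by
  have hd : ∀ t : ℝ, HasDerivAt (fun t : ℝ => f (x + t • v)) (fderiv ℝ f (x + t • v) v) t := by
    intro t
    have h1 : HasDerivAt (fun t : ℝ => x + t • v) v t := by
      simpa using ((hasDerivAt_id t).smul_const v).const_add x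
    exact (hf _).hasFDerivAt.comp_hasDerivAt t h1
  have hm : Monotone fun t : ℝ => f (x + t • v) :=
    monotone_of_deriv_nonneg (fun t => (hd t).differentiableAt) fun t => by
      rw [(hd t).deriv]
      exact hv _
  simpa using hm zero_le_one

/-- The comparison of skew-normal expectations, for a function on `Fin n → Fin p → ℝ` whose
derivatives are expressed through `fderiv`. -/
theorem integral_skewNormalPDF_mono {n p : ℕ} {Ω Ω' : Matrix (Fin p × Fin n) (Fin p × Fin n) ℝ}
    (hΩ : Ω.PosDef) (hΩ' : Ω'.PosDef) (α α' : Fin p × Fin n → ℝ) (M M' : Fin n → Fin p → ℝ)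
    {f : (Fin n → Fin p → ℝ) → ℝ} (hf : Differentiable ℝ f)
    {f1 : Fin p × Fin n → (Fin n → Fin p → ℝ) → ℝ}
    (hff1 : ∀ a x, fderiv ℝ f x (unvec n p (Pi.single a 1)) = f1 a x)
    (hf1 : ∀ a, Differentiable ℝ (f1 a))
    (h1 : ∀ x, 0 ≤ ∑ a, ∑ b, (Ω' - Ω) a b * fderiv ℝ (f1 b) x (unvec n p (Pi.single a 1)))
    (h2 : ∀ x, 0 ≤ fderiv ℝ f x (M' - M))
    (h3 : ∀ x, 0 ≤ ∑ a, (deltaOfAlpha Ω' α' - deltaOfAlpha Ω α) a * f1 a x)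
    (hi : Integrable fun z => f (M + unvec n p z) * skewNormalPDF 0 Ω α z)
    (hi' : Integrable fun z => f (M' + unvec n p z) * skewNormalPDF 0 Ω' α' z) :
    ∫ z, f (M + unvec n p z) * skewNormalPDF 0 Ω α z ≤
      ∫ z, f (M' + unvec n p z) * skewNormalPDF 0 Ω' α' z := by
  have hfd : ∀ (φ : (Fin n → Fin p → ℝ) → ℝ), Differentiable ℝ φ →
      ∀ z v, fderiv ℝ (fun z => φ (M + unvec n p z)) z v =
        fderiv ℝ φ (M + unvec n p z) (unvec n p v) := fun φ hφ z v => by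
    have h := (hφ (M + unvec n p z)).hasFDerivAt.comp z
      ((unvec n p).hasFDerivAt.const_add M)
    exact congrArg (fun L => L v) h.fderiv
  have hdiff : ∀ (φ : (Fin n → Fin p → ℝ) → ℝ), Differentiable ℝ φ →
      ∀ M : Fin n → Fin p → ℝ, Differentiable ℝ fun z => φ (M + unvec n p z) :=
    fun φ hφ M => hφ.comp ((unvec n p).differentiable.const_add M)
  have ht := tendsto_integral_truncatedExp hΩ α (hdiff f hf M).continuous hi
  have ht' := tendsto_integral_truncatedExp hΩ' α' (hdiff f hf M').continuous hi'
  obtain ⟨-, -, hA, -⟩ := jointCov_deltaOfAlpha hΩ α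
  obtain ⟨-, -, hA', -⟩ := jointCov_deltaOfAlpha hΩ' α'
  have hle := le_of_tendsto_of_tendsto' ht ht' fun m => ?_
  -- The limits for both laws carry the same positive constant, which cancels.
  · exact le_of_mul_le_mul_left hle (by positivity)
  -- First the joint covariance changes with the location held at `M`; then the location moves to
  -- `M'` under the new covariance, pointwise in `z`.
  refine (integral_ellipticPDF_mono (truncatedExp m) hA hA' (jointCov_sub _ _ _ _)
    (hdiff f hf M) (g1 := fun a z => f1 a (M + unvec n p z)) (fun b => hdiff _ (hf1 b) M)
    (fun a z => by rw [hfd f hf, hff1]) (fun z => ?_) (fun z => h3 _)).trans ?_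
  · simp only [hfd _ (hf1 _)]
    exact h1 _
  · refine integral_mono (integrable_mul_ellipticPDF _ hA' (hdiff f hf M).continuous)
      (integrable_mul_ellipticPDF _ hA' (hdiff f hf M').continuous) fun x => ?_
    refine mul_le_mul_of_nonneg_right ?_ (ellipticPDF_nonneg _ _ _)
    have := le_add_of_fderiv_nonneg hf h2 (M + unvec n p x.2)
    rwa [show M + unvec n p x.2 + (M' - M) = M' + unvec n p x.2 by abel] at this

theorem apply_eq_sum_unvec_single {n p : ℕ} (L : (Fin n → Fin p → ℝ) →L[ℝ] ℝ)
    (N : Fin n → Fin p → ℝ) :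
    L N = ∑ k, ∑ j, N k j * L (unvec n p (Pi.single (j, k) 1)) := by
  have : N = ∑ k, ∑ j, N k j • unvec n p (Pi.single (j, k) 1) := by
    ext k j
    simp [unvec, Pi.single_apply, Finset.sum_apply, Prod.mk.injEq, ite_and]
  conv_lhs => rw [this]
  simp only [map_sum, map_smul, smul_eq_mul]

end SkewNormal


/-! ### The main theorem -/

/-- Comparison of expectations of matrix variate skew-normal distributions. The skew-normal laws are
approximated by skew-elliptical laws of compact support, for which the interpolation argument only
involves compactly supported functions; this makes the conditions `hbdry` at infinity dispensable. -/
theorem mainTheorem9 {n p : ℕ}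
    {Ω₁ : Type*} [MeasurableSpace Ω₁] (P₁ : Measure Ω₁) [IsProbabilityMeasure P₁]
    {Ω₂ : Type*} [MeasurableSpace Ω₂] (P₂ : Measure Ω₂) [IsProbabilityMeasure P₂]
    (X : Ω₁ → Matrix (Fin n) (Fin p) ℝ) (Y : Ω₂ → Matrix (Fin n) (Fin p) ℝ)
    (M M' B B' : Matrix (Fin n) (Fin p) ℝ)
    (V V' : Matrix (Fin p) (Fin p) ℝ) (S S' : Matrix (Fin n) (Fin n) ℝ)
    (hV : V.PosDef) (hV' : V'.PosDef) (hS : S.PosDef) (hS' : S'.PosDef)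
    (hX : HasLaw X (SkewNormal.matrixSkewNormal M (V ⊗ₖ S) B) P₁)
    (hY : HasLaw Y (SkewNormal.matrixSkewNormal M' (V' ⊗ₖ S') B') P₂)
    (δ δ' : Fin p × Fin n → ℝ)
    (hδ : δ = SkewNormal.deltaOfAlpha (V ⊗ₖ S) B.vec)
    (hδ' : δ' = SkewNormal.deltaOfAlpha (V' ⊗ₖ S') B'.vec)
    (f : Matrix (Fin n) (Fin p) ℝ → ℝ)
    (hf : Differentiable ℝ f) (hf' : Differentiable ℝ (fderiv ℝ f))
    (hbdry : ∀ t ∈ Set.Icc (0 : ℝ) 1,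
      SkewNormal.BoundaryCondition f
        (SkewNormal.deltaSkewNormalPDF (t • M' + (1 - t) • M)
          (t • (V' ⊗ₖ S') + (1 - t) • (V ⊗ₖ S)) (t • δ' + (1 - t) • δ)) ∧
      SkewNormal.BoundaryCondition f
        (SkewNormal.reducedNormalPDF (t • M' + (1 - t) • M)
          (t • (V' ⊗ₖ S') + (1 - t) • (V ⊗ₖ S)) (t • δ' + (1 - t) • δ)))
    (hfX : Integrable (fun w => f (X w)) P₁) (hfY : Integrable (fun w => f (Y w)) P₂)
    (h1 : ∀ A : Matrix (Fin n) (Fin p) ℝ,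
      0 ≤ ∑ k : Fin n, ∑ l : Fin n, ∑ i : Fin p, ∑ j : Fin p,
        (V' i j * S' k l - V i j * S k l) *
          SkewNormal.partialDeriv k i (SkewNormal.partialDeriv l j f) A)
    (h2 : ∀ A : Matrix (Fin n) (Fin p) ℝ,
      0 ≤ ∑ k : Fin n, ∑ j : Fin p, (M' k j - M k j) * SkewNormal.partialDeriv k j f A)
    (h3 : ∀ A : Matrix (Fin n) (Fin p) ℝ,
      0 ≤ ∑ k : Fin n, ∑ j : Fin p,
        (δ' (j, k) - δ (j, k)) * SkewNormal.partialDeriv k j f A) :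
    ∫ w, f (X w) ∂P₁ ≤ ∫ w, f (Y w) ∂P₂ := by
  let F : (Fin n → Fin p → ℝ) → ℝ := f
  have hF : Differentiable ℝ F := hf
  have hF' : Differentiable ℝ (fderiv ℝ F) := hf'
  have hΩ := hV.kronecker hS
  have hΩ' := hV'.kronecker hS'
  have hpd : ∀ (φ : (Fin n → Fin p → ℝ) → ℝ), Differentiable ℝ φ → ∀ (k : Fin n) (j : Fin p) A,
      SkewNormal.partialDeriv k j φ A =
        fderiv ℝ φ A (SkewNormal.unvec n p (Pi.single (j, k) 1)) := by
    intro φ hφ k j A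
    rw [SkewNormal.unvec_single]
    exact (hφ A).lineDeriv_eq_fderiv
  have hpd' : ∀ (k : Fin n) (j : Fin p), SkewNormal.partialDeriv k j f =
      fun A => fderiv ℝ F A (SkewNormal.unvec n p (Pi.single (j, k) 1)) :=
    fun k j => funext fun A => hpd F hF k j A
  have hF1 : ∀ a, Differentiable ℝ fun A => fderiv ℝ F A (SkewNormal.unvec n p (Pi.single a 1)) :=
    fun a A => (hF' A).clm_apply (differentiableAt_const _)
  obtain ⟨hiX, hEX⟩ := SkewNormal.expectation_matrixSkewNormal hX hF.continuous hfX
  obtain ⟨hiY, hEY⟩ := SkewNormal.expectation_matrixSkewNormal hY hF.continuous hfY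
  refine hEX.trans_le (le_of_le_of_eq ?_ hEY.symm)
  refine SkewNormal.integral_skewNormalPDF_mono hΩ hΩ' B.vec B'.vec M M' hF
    (fun a x => rfl) hF1 (fun x => ?_) (fun x => ?_) (fun x => ?_) hiX hiY
  · refine (h1 x).trans_eq ?_
    have hterm : ∀ (k l : Fin n) (i j : Fin p),
        SkewNormal.partialDeriv k i (SkewNormal.partialDeriv l j f) x =
          fderiv ℝ (fun A => fderiv ℝ F A (SkewNormal.unvec n p (Pi.single (j, l) 1))) x
            (SkewNormal.unvec n p (Pi.single (i, k) 1)) := fun k l i j => by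
      rw [hpd']
      exact hpd _ (hF1 (j, l)) k i x
    simp only [hterm, Fintype.sum_prod_type, Matrix.sub_apply, kroneckerMap_apply]
    -- The sums are reordered from `k, l, i, j` to the pairs `(i, k)`, `(j, l)` that index the
    -- Kronecker product.
    refine Eq.trans ?_ Finset.sum_comm
    refine Finset.sum_congr rfl fun k _ => ?_
    rw [Finset.sum_comm]
    exact Finset.sum_congr rfl fun i _ => Finset.sum_comm
  · refine (h2 x).trans_eq ?_
    simp only [hpd']
    exact (SkewNormal.apply_eq_sum_unvec_single (fderiv ℝ F x) _).symm
  · refine (h3 x).trans_eq ?_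
    rw [Fintype.sum_prod_type, Finset.sum_comm]
    simp only [hpd', hδ, hδ', Pi.sub_apply]
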